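/- Let $R$ be a commutative ring with identity $1\neq 0$ and with $\mathrm{char}(R)\neq 2$, and let $R_2=\{r\in R\mid 2r=0\}$, an ideal of $R$. Let $G$ be a non-abelian group with derived subgroup $G'$, and let $\varphi$ be an involution on $G$, i.e. a map $\varphi:G\to G$ with $\varphi(gh)=\varphi(h)\varphi(g)$ and $\varphi(\varphi(g))=g$ for all $g,h\in G$. Put $G_\varphi=\{g\in G\mid\varphi(g)=g\}$ and $K=\langle g\in G\mid g\notin G_\varphi\rangle$. Denote again by $\varphi$ the involution induced on $G/G'$, with fixed set $(G/G')_\varphi$, and the $R$-linear extension of $\varphi$ to the group ring $RG$, and put $(RG)_\varphi^-=\{\alpha\in RG\mid\varphi(\alpha)=-\alpha\}$. Then $(RG)_\varphi^-$ is commutative (that is, $\alpha\beta=\beta\alpha$ for all $\alpha,\beta\in(RG)_\varphi^-$) if and only if one of the following conditions holds: 1. $K$ is abelian and $R_2^2=\{0\}$; 2. $R_2=\{0\}$ and $G$ contains an abelian subgroup of index $2$ that is contained in $G_\varphi$; 3. $\mathrm{char}(R)=4$, $|G'|=2$, $G/G'=(G/G')_\varphi$, $g^2\in G_\varphi$ for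 all $g\in G$, and the elements of $G_\varphi$ commute with each other in case $R_2^2\neq\{0\}$; 4. $\mathrm{char}(R)=3$, $|G'|=3$, $G/G'=(G/G')_\varphi$, and $g^3\in G_\varphi$ for all $g\in G$. Moreover, if $K$ is abelian, then there is an $x\in G_\varphi$ such that $G=K\cup Kx$ and $\varphi(k)=xkx^{-1}$ for all $k\in K$. -/

import Mathlib

/-- An involution on a group `G`: an anti-automorphism of `G` whose square is the identity. -/
structure GroupInvolution (G : Type*) [Group G] where
  /-- the underlying map -/
  toFun : G → G
  map_mul' : ∀ g h : G, toFun (g * h) = toFun h * toFun g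
  map_map' : ∀ g : G, toFun (toFun g) = g

namespace GroupInvolution

variable {G : Type*} [Group G]

instance : CoeFun (GroupInvolution G) (fun _ => G → G) := ⟨GroupInvolution.toFun⟩

theorem map_mul (φ : GroupInvolution G) (g h : G) : φ (g * h) = φ h * φ g := φ.map_mul' g h

theorem map_map (φ : GroupInvolution G) (g : G) : φ (φ g) = g := φ.map_map' g

theorem map_one (φ : GroupInvolution G) : φ 1 = 1 := by
  have h := φ.map_mul 1 1
  rw [mul_one] at h
  exact left_eq_mul.mp h

theorem map_inv (φ : GroupInvolution G) (g : G) : φ g⁻¹ = (φ g)⁻¹ := by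
  apply eq_inv_of_mul_eq_one_left
  rw [← φ.map_mul, mul_inv_cancel, φ.map_one]

/-- The set `G_φ` of `φ`-symmetric elements of `G`. -/
def fixed (φ : GroupInvolution G) : Set G := {g | φ g = g}

/-- The subgroup `K` of `G` generated by the elements that are not `φ`-symmetric. -/
def nonfixedSubgroup (φ : GroupInvolution G) : Subgroup G := Subgroup.closure {g | g ∉ φ.fixed}

/-- An involution maps the derived subgroup into itself. -/
theorem map_mem_commutator (φ : GroupInvolution G) {g : G} (hg : g ∈ commutator G) :
    φ g ∈ commutator G := by
  let α : G →* G :=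
    { toFun := fun g => (φ g)⁻¹
      map_one' := by rw [φ.map_one, inv_one]
      map_mul' := fun a b => by rw [φ.map_mul, mul_inv_rev] }
  have h : α g ∈ (commutator G).map α := Subgroup.mem_map_of_mem α hg
  rw [commutator_def, Subgroup.map_commutator] at h
  have h2 : α g ∈ commutator G := by
    rw [commutator_def]
    exact Subgroup.commutator_mono le_top le_top h
  exact inv_mem_iff.mp h2

/-- The involution induced by `φ` on the quotient `G / G'` of `G` by its derived subgroup. -/
def onQuotient (φ : GroupInvolution G) : GroupInvolution (G ⧸ commutator G) where
  toFun := Quotient.map' φ (by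
    intro a b hab
    rw [QuotientGroup.leftRel_apply] at hab ⊢
    have h : b * a⁻¹ ∈ commutator G := by
      have := Subgroup.Normal.conj_mem inferInstance _ hab a
      rwa [mul_inv_cancel_left] at this
    have h2 := φ.map_mem_commutator h
    rwa [φ.map_mul, φ.map_inv] at h2)
  map_mul' := by
    rintro ⟨a⟩ ⟨b⟩
    exact congrArg (QuotientGroup.mk (s := commutator G)) (φ.map_mul a b)
  map_map' := by
    rintro ⟨a⟩
    exact congrArg (QuotientGroup.mk (s := commutator G)) (φ.map_map a)

/-- The `R`-linear extension of `φ` to the group ring `RG`. -/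
noncomputable def linearExtension (R : Type*) [CommRing R] (φ : GroupInvolution G) :
    MonoidAlgebra R G →ₗ[R] MonoidAlgebra R G :=
  MonoidAlgebra.mapDomainLinearMap R R φ

/-- The set of `φ`-antisymmetric elements of the group ring `RG`. -/
def antisymmetric (R : Type*) [CommRing R] (φ : GroupInvolution G) : Set (MonoidAlgebra R G) :=
  {α | φ.linearExtension R α = -α}

end GroupInvolution

/-- The ideal `R₂ = {r ∈ R | 2 r = 0}` of `R`. -/
def twoTorsionIdeal (R : Type*) [CommRing R] : Ideal R := Submodule.torsionBy R R 2

namespace GroupInvolution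

open scoped commutatorElement

variable {G : Type*} [Group G] {R : Type*} [CommRing R]

/-! The antisymmetric elements are spanned by `g - φ g` (`g` nonfixed) and `r g` (`2 r = 0`, `g`
fixed), so commutativity is a condition on pairs of group elements (`antisymmetric_commute_iff`).
Reading the coefficient of `g * h` in the commutator of two skew elements shows that nonfixed `g`,
`h` commute, have a fixed product, or satisfy extra coincidences possible only in characteristic 3
or 4 (`trichotomy_of_skew_commute`).

Necessity. If `K` is abelian, `φ` acts on `K` as conjugation by any element outside `K`, and `R₂² =
0` follows. Let `K` be nonabelian. If `R₂ ≠ 0`, characteristic 3 is excluded, and commuting with the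
elements `r f` produces a central `s` of order two with `φ a ∈ {a, s a}` for all `a`. If `R₂ = 0`,
characteristic 4 is excluded. Either some cubic pair exists, whose commutator `s` of order three
turns out to be central with `φ a ∈ {a, s a, s² a}`, or all noncommuting nonfixed elements form
fixed pairs, and then products of two nonfixed elements generate an abelian subgroup of index two
inside `G_φ`. In the two central cases `G' = ⟨s⟩`.

Sufficiency. In conditions 3 and 4, `g - φ g = (1 - a) g` with `a ∈ G'`, and the commutator of two
such elements is a multiple of `(1 - a)(1 - b)(1 - c)`, which vanishes because `(1 - s)³` does.
Conditions 1 and 2 are matched term by term. -/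

theorem mem_fixed {φ : GroupInvolution G} {g : G} : g ∈ φ.fixed ↔ φ g = g := Iff.rfl

theorem injective (φ : GroupInvolution G) : Function.Injective φ :=
  Function.LeftInverse.injective φ.map_map

/-! ### Generators of the antisymmetric elements -/

theorem mem_antisymmetric_iff {φ : GroupInvolution G} {α : MonoidAlgebra R G} :
    α ∈ φ.antisymmetric R ↔ ∀ g, α.coeff (φ g) = -α.coeff g := by
  have key : ∀ g, (φ.linearExtension R α).coeff g = α.coeff (φ g) := by
    intro g
    rw [linearExtension, MonoidAlgebra.coeff_mapDomainLinearMap]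
    conv_lhs => rw [← φ.map_map g]
    exact Finsupp.mapDomain_apply φ.injective _ _
  constructor
  · intro h g
    rw [← key, show φ.linearExtension R α = -α from h]
    rfl
  · intro h
    refine MonoidAlgebra.ext (Finsupp.ext fun g => ?_)
    rw [key, h]
    rfl

/-- The antisymmetric element `g - φ g` of the group ring. -/
noncomputable def skew (R : Type*) [CommRing R] (φ : GroupInvolution G) (g : G) :
    MonoidAlgebra R G :=
  MonoidAlgebra.single g 1 - MonoidAlgebra.single (φ g) 1

/-- The elements `g - φ g` with `g` not fixed, and `r g` with `2 r = 0` and `g` fixed. -/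
def skewGenerators (R : Type*) [CommRing R] (φ : GroupInvolution G) : Set (MonoidAlgebra R G) :=
  {α | (∃ g, g ∉ φ.fixed ∧ α = φ.skew R g) ∨
    ∃ r ∈ twoTorsionIdeal R, ∃ g ∈ φ.fixed, α = MonoidAlgebra.single g r}

theorem mem_twoTorsionIdeal {r : R} : r ∈ twoTorsionIdeal R ↔ 2 * r = 0 := by
  simp [twoTorsionIdeal, Submodule.mem_torsionBy_iff]

theorem skew_mem_antisymmetric (φ : GroupInvolution G) (g : G) :
    φ.skew R g ∈ φ.antisymmetric R := by
  show φ.linearExtension R _ = -_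
  simp [skew, linearExtension, φ.map_map]

theorem single_mem_antisymmetric {φ : GroupInvolution G} {g : G} (hg : g ∈ φ.fixed) {r : R}
    (hr : r ∈ twoTorsionIdeal R) : MonoidAlgebra.single g r ∈ φ.antisymmetric R := by
  show φ.linearExtension R _ = -_
  rw [mem_twoTorsionIdeal, two_mul] at hr
  rw [linearExtension, MonoidAlgebra.mapDomainLinearMap_single, mem_fixed.mp hg,
    eq_neg_iff_add_eq_zero, ← MonoidAlgebra.single_add, hr, MonoidAlgebra.single_zero]

/-- Induction on the size of the support: a multiple of a generator that agrees with `α` at `g` is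
subtracted. The support does not grow, since the coefficient at `φ g` is minus the one at `g`, so `φ
g` is already in it. -/
theorem mem_span_skewGenerators {φ : GroupInvolution G} {α : MonoidAlgebra R G}
    (hα : α ∈ φ.antisymmetric R) : α ∈ Submodule.span R (φ.skewGenerators R) := by
  classical
  induction hn : α.coeff.support.card using Nat.strong_induction_on generalizing α with
  | _ n ih =>
    rcases Finset.eq_empty_or_nonempty α.coeff.support with h0 | ⟨g, hg⟩
    · rw [Finsupp.support_eq_empty, MonoidAlgebra.coeff_eq_zero] at h0
      rw [h0]
      exact zero_mem _
    · have hα' := mem_antisymmetric_iff.mp hα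
      have hgne : α.coeff g ≠ 0 := Finsupp.mem_support_iff.mp hg
      obtain ⟨β, hβs, hβa, hβg, hβ⟩ : ∃ β : MonoidAlgebra R G,
          β ∈ Submodule.span R (φ.skewGenerators R) ∧ β ∈ φ.antisymmetric R ∧
          β.coeff g = α.coeff g ∧ ∀ x, x ∉ α.coeff.support → β.coeff x = 0 := by
        by_cases hf : g ∈ φ.fixed
        · have hr : α.coeff g ∈ twoTorsionIdeal R := by
            have := hα' g
            rw [mem_fixed.mp hf, eq_neg_iff_add_eq_zero] at this
            rwa [mem_twoTorsionIdeal, two_mul]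
          refine ⟨MonoidAlgebra.single g (α.coeff g),
            Submodule.subset_span (Or.inr ⟨_, hr, g, hf, rfl⟩), single_mem_antisymmetric hf hr,
            by simp, fun x hx => ?_⟩
          have : g ≠ x := by rintro rfl; exact hx hg
          simp [this]
        · have hne : φ g ≠ g := hf
          refine ⟨α.coeff g • φ.skew R g,
            Submodule.smul_mem _ _ (Submodule.subset_span (Or.inl ⟨g, hf, rfl⟩)), ?_, ?_, ?_⟩
          · have := φ.skew_mem_antisymmetric (R := R) g
            show φ.linearExtension R _ = -_
            rw [map_smul, show φ.linearExtension R (φ.skew R g) = -_ from this, smul_neg]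
          · simp [skew, hne]
          · intro x hx
            have h1 : g ≠ x := by rintro rfl; exact hx hg
            have h2 : φ g ≠ x := by
              rintro rfl
              refine hx (Finsupp.mem_support_iff.mpr ?_)
              rw [hα']
              exact neg_ne_zero.mpr hgne
            simp [skew, h1, h2]
      have hsub : α - β ∈ φ.antisymmetric R := by
        show φ.linearExtension R _ = -_
        rw [map_sub, show φ.linearExtension R α = -α from hα,
          show φ.linearExtension R β = -β from hβa]
        abel
      have hlt : (α - β).coeff.support.card < n := by
        rw [← hn]
        refine Finset.card_lt_card ((Finset.ssubset_iff_of_subset fun x hx => ?_).mpr ⟨g, hg, ?_⟩)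
        · by_contra hx'
          refine Finsupp.mem_support_iff.mp hx ?_
          have h1 : α.coeff x = 0 := Finsupp.notMem_support_iff.mp hx'
          show α.coeff x - β.coeff x = 0
          rw [h1, hβ x hx', sub_zero]
        · rw [Finsupp.notMem_support_iff]
          show α.coeff g - β.coeff g = 0
          rw [hβg, sub_self]
      have := add_mem (ih _ hlt hsub rfl) hβs
      rwa [sub_add_cancel] at this

/-- Commutativity of the antisymmetric elements can be checked on generators. -/
theorem antisymmetric_commute_iff (φ : GroupInvolution G) :
    (∀ α ∈ φ.antisymmetric R, ∀ β ∈ φ.antisymmetric R, α * β = β * α) ↔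
      (∀ g, g ∉ φ.fixed → ∀ h, h ∉ φ.fixed → φ.skew R g * φ.skew R h = φ.skew R h * φ.skew R g) ∧
      (∀ r ∈ twoTorsionIdeal R, ∀ f ∈ φ.fixed, ∀ g, g ∉ φ.fixed →
        MonoidAlgebra.single f r * φ.skew R g = φ.skew R g * MonoidAlgebra.single f r) ∧
      (∀ r ∈ twoTorsionIdeal R, ∀ s ∈ twoTorsionIdeal R, ∀ f ∈ φ.fixed, ∀ f' ∈ φ.fixed,
        MonoidAlgebra.single (f * f') (r * s) = MonoidAlgebra.single (f' * f) (r * s)) := by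
  constructor
  · intro H
    refine ⟨fun g _ h _ => H _ (φ.skew_mem_antisymmetric g) _ (φ.skew_mem_antisymmetric h),
      fun r hr f hf g _ => H _ (single_mem_antisymmetric hf hr) _ (φ.skew_mem_antisymmetric g),
      fun r hr s hs f hf f' hf' => ?_⟩
    have := H _ (single_mem_antisymmetric hf hr) _ (single_mem_antisymmetric hf' hs)
    rwa [MonoidAlgebra.single_mul_single, MonoidAlgebra.single_mul_single, mul_comm s r] at this
  · rintro ⟨ha, hb, hc⟩
    have hgen : ∀ α ∈ φ.skewGenerators R, ∀ β ∈ φ.skewGenerators R, α * β = β * α := by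
      rintro α (⟨g, hg, rfl⟩ | ⟨r, hr, f, hf, rfl⟩) β (⟨h, hh, rfl⟩ | ⟨s, hs, f', hf', rfl⟩)
      · exact ha g hg h hh
      · exact (hb s hs f' hf' g hg).symm
      · exact hb r hr f hf h hh
      · rw [MonoidAlgebra.single_mul_single, MonoidAlgebra.single_mul_single, mul_comm s r]
        exact hc r hr s hs f hf f' hf'
    intro α hα β hβ
    replace hα := mem_span_skewGenerators hα
    replace hβ := mem_span_skewGenerators hβ
    induction hα using Submodule.span_induction with
    | zero => simp
    | add x y _ _ hx hy => rw [add_mul, mul_add, hx, hy]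
    | smul r x _ hx => rw [smul_mul_assoc, mul_smul_comm, hx]
    | mem x hx =>
      induction hβ using Submodule.span_induction with
      | zero => simp
      | add y z _ _ hy hz => rw [add_mul, mul_add, hy, hz]
      | smul r y _ hy => rw [smul_mul_assoc, mul_smul_comm, hy]
      | mem y hy => exact hgen x hx y hy

/-! ### Comparison of coefficients -/

theorem ringChar_eq_three [Nontrivial R] (h : (3 : R) = 0) : ringChar R = 3 := by
  have h3 : ringChar R ∣ 3 := ringChar.dvd (by exact_mod_cast h)
  rcases (Nat.dvd_prime Nat.prime_three).mp h3 with h1 | h1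
  · exact absurd h1 CharP.ringChar_ne_one
  · exact h1

theorem two_ne_zero_of_ringChar [Nontrivial R] (hR : ringChar R ≠ 2) : (2 : R) ≠ 0 := by
  intro h
  have h2 : ringChar R ∣ 2 := ringChar.dvd (by exact_mod_cast h)
  rcases (Nat.dvd_prime Nat.prime_two).mp h2 with h1 | h1
  · exact absurd h1 CharP.ringChar_ne_one
  · exact hR h1

theorem ringChar_eq_four [Nontrivial R] (hR : ringChar R ≠ 2) (h : (4 : R) = 0) :
    ringChar R = 4 := by
  have h4 : ringChar R ∣ 2 ^ 2 := ringChar.dvd (by push_cast; linear_combination h)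
  obtain ⟨k, hk, hk'⟩ := (Nat.dvd_prime_pow Nat.prime_two).mp h4
  interval_cases k
  · exact absurd hk' CharP.ringChar_ne_one
  · exact absurd hk' hR
  · exact hk'

/-- Outside the first two cases, the coefficient at `g * h` reads `1 + n = 0`, where `n ≤ 3` counts
which of `φ g * φ h`, `h * φ g`, `φ h * g` equal `g * h`. As `1` and `2` are nonzero, `n` is 2 or 3,
which gives characteristic 3 or 4. -/
theorem trichotomy_of_skew_commute [Nontrivial R] (hR : ringChar R ≠ 2) {φ : GroupInvolution G}
    {g h : G} (hg : g ∉ φ.fixed) (hh : h ∉ φ.fixed)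
    (H : φ.skew R g * φ.skew R h = φ.skew R h * φ.skew R g) :
    g * h = h * g ∨ g * h = φ h * φ g ∨
    (ringChar R = 3 ∧ ((g * h = h * φ g ∧ g * h = φ h * g ∧ g * h ≠ φ g * φ h) ∨
      (g * h = φ g * φ h ∧ g * h = h * φ g ∧ g * h ≠ φ h * g) ∨
      (g * h = φ g * φ h ∧ g * h = φ h * g ∧ g * h ≠ h * φ g))) ∨
    (ringChar R = 4 ∧ g * h = φ g * φ h ∧ g * h = h * φ g ∧ g * h = φ h * g) := by
  classical
  by_cases h1 : g * h = h * g
  · exact Or.inl h1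
  by_cases h2 : g * h = φ h * φ g
  · exact Or.inr (Or.inl h2)
  have hn1 : φ g * h ≠ g * h := fun e => hg (mul_right_cancel e)
  have hn2 : g * φ h ≠ g * h := fun e => hh (mul_left_cancel e)
  have two := two_ne_zero_of_ringChar hR
  have E := congrArg (fun α : MonoidAlgebra R G => α.coeff (g * h)) H
  simp only [skew, sub_mul, mul_sub, MonoidAlgebra.single_mul_single, mul_one,
    MonoidAlgebra.coeff_sub, Finsupp.sub_apply, MonoidAlgebra.coeff_single, Finsupp.single_apply,
    hn1, hn2, Ne.symm h1, Ne.symm h2, if_true, if_false] at E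
  by_cases a : φ g * φ h = g * h <;> by_cases b : h * φ g = g * h <;>
    by_cases c : φ h * g = g * h <;> simp only [a, b, c, if_true, if_false] at E
  · exact Or.inr (Or.inr (Or.inr ⟨ringChar_eq_four hR (by linear_combination E),
      a.symm, b.symm, c.symm⟩))
  · exact Or.inr (Or.inr (Or.inl ⟨ringChar_eq_three (by linear_combination E),
      Or.inr (Or.inl ⟨a.symm, b.symm, Ne.symm c⟩)⟩))
  · exact Or.inr (Or.inr (Or.inl ⟨ringChar_eq_three (by linear_combination E),
      Or.inr (Or.inr ⟨a.symm, c.symm, Ne.symm b⟩)⟩))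
  · exact absurd (by linear_combination E) two
  · exact Or.inr (Or.inr (Or.inl ⟨ringChar_eq_three (by linear_combination E),
      Or.inl ⟨b.symm, c.symm, Ne.symm a⟩⟩))
  · exact absurd (by linear_combination E) two
  · exact absurd (by linear_combination E) two
  · exact absurd (by linear_combination E) (one_ne_zero (α := R))

theorem commute_or_swap {φ : GroupInvolution G} {r : R} (hr0 : r ≠ 0) {f g : G}
    (hg : g ∉ φ.fixed)
    (H : MonoidAlgebra.single f r * φ.skew R g = φ.skew R g * MonoidAlgebra.single f r) :
    f * g = g * f ∨ (f * g = φ g * f ∧ f * φ g = g * f) := by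
  classical
  by_cases h1 : f * g = g * f
  · exact Or.inl h1
  have hn1 : f * φ g ≠ f * g := fun e => hg (mul_left_cancel e)
  have hn2 : φ g * f ≠ g * f := fun e => hg (mul_right_cancel e)
  have E1 := congrArg (fun α : MonoidAlgebra R G => α.coeff (f * g)) H
  have E2 := congrArg (fun α : MonoidAlgebra R G => α.coeff (g * f)) H
  simp only [skew, sub_mul, mul_sub, MonoidAlgebra.single_mul_single, mul_one, one_mul,
    MonoidAlgebra.coeff_sub, Finsupp.sub_apply, MonoidAlgebra.coeff_single, Finsupp.single_apply,
    hn1, hn2, h1, Ne.symm h1, if_true, if_false] at E1 E2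
  refine Or.inr ⟨?_, ?_⟩
  · by_contra hc
    rw [if_neg (Ne.symm hc)] at E1
    exact hr0 (by linear_combination E1)
  · by_contra hc
    rw [if_neg hc] at E2
    exact hr0 (by linear_combination -E2)

/-! ### Cubic pairs -/

theorem reassoc {a b c : G} (h : a * b = c) (z : G) : a * (b * z) = c * z := by
  rw [← h, mul_assoc]

/-- Like `reassoc`, this lets a relation rewrite inside a right-associated word, so that `simp only`
with `mul_assoc` can normalise words. -/
theorem reassoc₃ {a b c d : G} (h : a * (b * c) = d) (z : G) : a * (b * (c * z)) = d * z := by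
  rw [← h, mul_assoc, mul_assoc]

theorem map_eq (φ : GroupInvolution G) {a b c d : G} (h : a * b = c * d) :
    φ b * φ a = φ d * φ c := by
  rw [← φ.map_mul, ← φ.map_mul, h]

theorem mul_mem_fixed_iff {φ : GroupInvolution G} {a b : G} :
    a * b ∈ φ.fixed ↔ a * b = φ b * φ a := by
  rw [mem_fixed, φ.map_mul, eq_comm]

theorem map_notMem_fixed {φ : GroupInvolution G} {g : G} (hg : g ∉ φ.fixed) : φ g ∉ φ.fixed :=
  fun h => hg (φ.injective h)

theorem inv_notMem_fixed {φ : GroupInvolution G} {g : G} (hg : g ∉ φ.fixed) : g⁻¹ ∉ φ.fixed :=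
  fun h => hg (by rw [mem_fixed, φ.map_inv] at h; exact inv_injective h)

/-- Two elements that commute with their commutator `s` of order three and that `φ` multiplies
by `s` or `s²`. -/
def CubicPair (φ : GroupInvolution G) (g h : G) : Prop :=
  ∃ s : G, s * (s * s) = 1 ∧ s ≠ 1 ∧ g * s = s * g ∧ h * s = s * h ∧ g * h = s * (h * g) ∧
    (φ g = s * g ∨ φ g = s * (s * g)) ∧ (φ h = s * h ∨ φ h = s * (s * h))

/-- The reversed pair has commutator `s⁻¹ = s * s`, and the two possible multipliers exchange roles.
-/
theorem CubicPair.symm {φ : GroupInvolution G} {g h : G} (H : φ.CubicPair g h) :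
    φ.CubicPair h g := by
  obtain ⟨s, s3, s1, sg, sh, gh, hg', hh'⟩ := H
  refine ⟨s * s, ?_, fun e => s1 (by simpa [e] using s3), ?_, ?_, ?_, ?_, ?_⟩
  · simp only [mul_assoc, s3, mul_one]
  · simp only [mul_assoc, sh, reassoc sh]
  · simp only [mul_assoc, sg, reassoc sg]
  · simp only [mul_assoc, gh, reassoc₃ s3, one_mul]
  · rcases hh' with e | e
    · right; simp only [mul_assoc, e, reassoc₃ s3, one_mul]
    · left; rw [e, mul_assoc]
  · rcases hg' with e | e
    · right; simp only [mul_assoc, e, reassoc₃ s3, one_mul]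
    · left; rw [e, mul_assoc]

theorem CubicPair.map_right {φ : GroupInvolution G} {g h : G} (H : φ.CubicPair g h) :
    φ.CubicPair g (φ h) := by
  obtain ⟨s, s3, s1, sg, sh, gh, hg', hh'⟩ := H
  refine ⟨s, s3, s1, sg, ?_, ?_, hg', ?_⟩
  · rcases hh' with e | e <;> simp only [e, mul_assoc, sh]
  · rcases hh' with e | e <;> simp only [e, mul_assoc, reassoc sg, gh]
  · rw [φ.map_map]
    rcases hh' with e | e
    · right; simp only [e, reassoc₃ s3, one_mul]
    · left; simp only [e, reassoc₃ s3, one_mul]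

theorem CubicPair.map_left {φ : GroupInvolution G} {g h : G} (H : φ.CubicPair g h) :
    φ.CubicPair (φ g) h := H.symm.map_right.symm

theorem CubicPair.not_commute {φ : GroupInvolution G} {g h : G} (H : φ.CubicPair g h) :
    g * h ≠ h * g := by
  obtain ⟨s, s3, s1, sg, sh, gh, -⟩ := H
  intro e
  exact s1 (mul_eq_right.mp (gh.symm.trans e))

theorem CubicPair.commute_map_right {φ : GroupInvolution G} {g h : G} (H : φ.CubicPair g h) :
    h * φ h = φ h * h := by
  obtain ⟨s, s3, s1, sg, sh, gh, hg', hh' | hh'⟩ := H <;>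
    simp only [hh', mul_assoc, reassoc sh]

/-- Take `s` to be the commutator. The relations and their images under `φ` give `φ h = s * h` and
`φ g = g * s`; cancellation makes `s` commute with `g` and `h`, and `h3` then becomes `s³ = 1`. -/
theorem CubicPair.of_eq {φ : GroupInvolution G} {g h : G} (hc : g * h ≠ h * g)
    (h1 : g * h = h * φ g) (h2 : g * h = φ h * g) (h3 : φ g * φ h = h * g) :
    φ.CubicPair g h := by
  obtain ⟨s, hs⟩ : ∃ s, g * h = s * (h * g) := ⟨g * h * (h * g)⁻¹, by group⟩
  have h1' := φ.map_eq h1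
  have h2' := φ.map_eq h2
  rw [φ.map_map] at h1' h2'
  have e1 : φ h = s * h := mul_right_cancel (b := g) (by rw [← h2, hs, mul_assoc])
  have e2 : φ g = g * s := mul_right_cancel (b := h) (by rw [← h2', h1', e1, mul_assoc])
  rw [e2] at h1
  rw [e1, e2] at h1' h3
  have e3 : g * s = s * g := mul_right_cancel (b := h) (by
    rw [mul_assoc, ← h1', mul_assoc, ← h1, mul_assoc])
  have e4 : h * s = s * h := mul_right_cancel (b := g) (by
    rw [mul_assoc, ← e3, ← h1, hs, mul_assoc])
  have e5 : s * (s * s) = 1 := mul_right_cancel (b := h * g) (by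
    simp only [mul_assoc, reassoc e3, hs] at h3
    simpa only [mul_assoc, one_mul] using h3)
  exact ⟨s, e5, fun e => hc (by rw [hs, e, one_mul]), e3, e4, hs, Or.inl (by rw [e2, e3]),
    Or.inl e1⟩

/-- The group-theoretic content of the commutativity of all `g - φ g` over a ring in which
`4 ≠ 0`. -/
def SkewTrichotomy (φ : GroupInvolution G) : Prop :=
  ∀ g, g ∉ φ.fixed → ∀ h, h ∉ φ.fixed → g * h = h * g ∨ g * h = φ h * φ g ∨
    ((g * h = h * φ g ∧ g * h = φ h * g ∧ g * h ≠ φ g * φ h) ∨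
      (g * h = φ g * φ h ∧ g * h = h * φ g ∧ g * h ≠ φ h * g) ∨
      (g * h = φ g * φ h ∧ g * h = φ h * g ∧ g * h ≠ h * φ g))

/-! ### Noncommuting nonfixed elements form fixed pairs or cubic pairs -/

variable {φ : GroupInvolution G}

/-- The relation missing for `CubicPair.of_eq` comes from the trichotomy for the reversed pair `(h,
g)`: every other alternative contradicts `hc` or the image of `h3` under `φ`. -/
theorem SkewTrichotomy.of_first (T : φ.SkewTrichotomy) {g h : G} (hg : g ∉ φ.fixed)
    (hh : h ∉ φ.fixed) (hc : g * h ≠ h * g) (h1 : g * h = h * φ g) (h2 : g * h = φ h * g)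
    (h3 : g * h ≠ φ g * φ h) : φ.CubicPair g h := by
  have h1' := φ.map_eq h1
  have h2' := φ.map_eq h2
  rw [φ.map_map] at h1' h2'
  have h3' : h * g ≠ φ h * φ g := fun e => h3 (by simpa only [φ.map_map] using φ.map_eq e.symm)
  refine CubicPair.of_eq hc h1 h2 ?_
  rcases T h hh g hg with e | e | ⟨e, -, -⟩ | ⟨-, e, -⟩ | ⟨-, e, -⟩
  · exact absurd e.symm hc
  · exact e.symm
  · exact absurd (e.trans h1'.symm) h3'
  · exact absurd (e.trans h1'.symm) h3'
  · exact absurd (e.trans h2'.symm) h3'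

/-- The last two alternatives of the trichotomy become the first for `(g, φ h)` and `(φ g, h)`, and
cubic pairs survive applying `φ` to one entry. -/
theorem SkewTrichotomy.commute_or_fixed_or_cubic (T : φ.SkewTrichotomy) {g h : G}
    (hg : g ∉ φ.fixed) (hh : h ∉ φ.fixed) :
    g * h = h * g ∨ g * h = φ h * φ g ∨ φ.CubicPair g h := by
  by_cases hc : g * h = h * g
  · exact Or.inl hc
  rcases T g hg h hh with e | e | ⟨h1, h2, h3⟩ | ⟨h1, h2, h3⟩ | ⟨h1, h2, h3⟩
  · exact Or.inl e
  · exact Or.inr (Or.inl e)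
  · exact Or.inr (Or.inr (T.of_first hg hh hc h1 h2 h3))
  · have h1' := φ.map_eq h1
    have h2' := φ.map_eq h2
    have h3' : φ h * φ g ≠ φ g * h := fun e => h3 (by simpa only [φ.map_map] using φ.map_eq e)
    rw [φ.map_map] at h1' h2'
    rw [φ.map_map] at h1'
    have : φ.CubicPair g (φ h) := by
      refine T.of_first hg (map_notMem_fixed hh) ?_ ?_ ?_ ?_
      · intro e
        exact hg (mul_left_cancel (h2'.trans e))
      · exact h2'.symm
      · rw [φ.map_map, ← h2', h1']
      · rwa [φ.map_map, ← h2']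
    exact Or.inr (Or.inr (by simpa [φ.map_map] using this.map_right))
  · have h1' := φ.map_eq h1
    have h2' := φ.map_eq h2
    have h3' : φ h * φ g ≠ g * φ h := fun e => h3 (by simpa only [φ.map_map] using φ.map_eq e)
    rw [φ.map_map] at h1' h2'
    rw [φ.map_map] at h1'
    have : φ.CubicPair (φ g) h := by
      refine T.of_first (map_notMem_fixed hg) hh ?_ ?_ ?_ ?_
      · intro e
        exact hh (mul_right_cancel (h2'.trans e))
      · rw [φ.map_map, ← h2', h1']
      · exact h2'.symm
      · rwa [φ.map_map, ← h2']
    exact Or.inr (Or.inr (by simpa [φ.map_map] using this.map_left))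

theorem SkewTrichotomy.commute_or_fixed_fixed_or_cubic (T : φ.SkewTrichotomy) {g h : G}
    (hg : g ∉ φ.fixed) (hh : h ∉ φ.fixed) :
    g * h = h * g ∨ (g * h = φ h * φ g ∧ h * g = φ g * φ h) ∨ φ.CubicPair g h := by
  rcases T.commute_or_fixed_or_cubic hg hh with e | e | e
  · exact Or.inl e
  · rcases T.commute_or_fixed_or_cubic hh hg with e' | e' | e'
    · exact Or.inl e'.symm
    · exact Or.inr (Or.inl ⟨e, e'⟩)
    · exact Or.inr (Or.inr e'.symm)
  · exact Or.inr (Or.inr e)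

/-- The element `s` commutes with `g * φ h` and `h`, hence with `φ h` and `g`. Since `φ h` is `s *
h` or `s² * h`, commuting with `φ h` passes to `h`. -/
theorem CubicPair.commute_of_mul_map {g h : G} (H : φ.CubicPair (g * φ h) h)
    (h3 : g * φ h = φ h * g) : g * h = h * g := by
  obtain ⟨s, -, -, sk, sh, -, -, hh'⟩ := H
  have hb : φ h * s = s * φ h := by
    rcases hh' with e | e <;> simp only [e, mul_assoc, sh]
  have hs : g * s = s * g := mul_left_cancel (a := φ h) (by
    rw [← mul_assoc, ← h3, sk, h3, ← mul_assoc, ← hb, mul_assoc])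
  rcases hh' with e | e <;> rw [e] at h3 <;>
    simp only [mul_assoc, reassoc hs, mul_right_inj] at h3 <;> exact h3

/-- By `h4` the element `g * φ h` is nonfixed, and it is tested against `h`. -/
theorem SkewTrichotomy.commute_of_commute_map (T : φ.SkewTrichotomy) {g h : G} (hg : g ∉ φ.fixed)
    (hh : h ∉ φ.fixed) (h1 : g * h = φ h * φ g) (h2 : h * g = φ g * φ h)
    (h3 : g * φ h = φ h * g) (h4 : g * φ h ≠ h * φ g) : g * h = h * g := by
  have hv : g * φ h ∉ φ.fixed := by rwa [mul_mem_fixed_iff, φ.map_map]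
  have h3' := φ.map_eq h3
  rw [φ.map_map] at h3'
  rcases T.commute_or_fixed_fixed_or_cubic hv hh with hk | ⟨e, -⟩ | e
  · by_contra hc
    -- The factor `u` commutes with `h` and `φ h`, so it cancels and leaves relations between `h`
    -- and `φ h` alone: they do not commute, their squares differ, and each commutes with the square
    -- of the other. The nonfixed element `h * h * φ h` tested against `h` then contradicts all of
    -- this.
    obtain ⟨u, hu⟩ : ∃ u, g = u * φ h := ⟨g * (φ h)⁻¹, by group⟩
    have ub : u * φ h = φ h * u := mul_right_cancel (b := φ h) (by rw [← hu, h3, hu, mul_assoc])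
    have ha : φ g = u * h := mul_left_cancel (a := φ h) (by
      rw [← h1, ← mul_assoc, ← ub, ← hu])
    have hu' : h * u = u * h := mul_right_cancel (b := φ h) (by
      rw [mul_assoc, ← hu, h2, ha])
    have hbb : φ h * (φ h * h) = h * (φ h * φ h) := mul_left_cancel (a := u) (by
      rw [hu] at hk
      simp only [mul_assoc, reassoc hu'] at hk
      exact hk)
    have hbh : φ h * h ≠ h * φ h := fun e => hc (by
      rw [hu, mul_assoc, e, ← mul_assoc, ← hu', mul_assoc])
    have hne : φ h * φ h ≠ h * h := fun e => h4 (by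
      rw [ha, hu, mul_assoc, e, ← mul_assoc, ← mul_assoc, hu'])
    have hw : h * (h * φ h) = φ h * (h * h) := by
      have := congrArg φ hbb
      simp only [φ.map_mul, φ.map_map, mul_assoc] at this
      exact this.symm
    have hvf : φ (h * h * φ h) = h * (φ h * φ h) := by
      simp only [φ.map_mul, φ.map_map]
    have hvn : h * h * φ h ∉ φ.fixed := by
      intro e
      rw [mem_fixed, hvf, mul_assoc] at e
      exact hh (mul_right_cancel (mul_left_cancel e))
    rcases T.commute_or_fixed_or_cubic hvn hh with e | e | e
    · simp only [mul_assoc, mul_right_inj] at e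
      exact hbh e
    · rw [hvf, ← hbb, mul_assoc h, hw, mul_assoc] at e
      exact hne (mul_right_cancel (b := h) (by
        rw [mul_assoc]; exact (mul_left_cancel e).symm))
    · exact hbh e.commute_map_right.symm
  · exfalso
    rw [φ.map_mul, φ.map_map, h3', h3, mul_assoc] at e
    exact hg (mul_right_cancel (mul_left_cancel e)).symm
  · exact e.commute_of_mul_map h3

/-- All products of `g` or `φ g` with `h` or `φ h` are fixed. -/
def FixedPair (φ : GroupInvolution G) (g h : G) : Prop :=
  g * h = φ h * φ g ∧ h * g = φ g * φ h ∧ g * φ h = h * φ g ∧ φ g * h = φ h * g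

theorem SkewTrichotomy.commute_or_fixedPair_or_cubic (T : φ.SkewTrichotomy) {g h : G}
    (hg : g ∉ φ.fixed) (hh : h ∉ φ.fixed) :
    g * h = h * g ∨ φ.FixedPair g h ∨ φ.CubicPair g h := by
  rcases T.commute_or_fixed_fixed_or_cubic hg hh with e | ⟨h1, h2⟩ | e
  · exact Or.inl e
  · by_cases h4 : g * φ h = h * φ g
    · by_cases h5 : φ g * h = φ h * g
      · exact Or.inr (Or.inl ⟨h1, h2, h4, h5⟩)
      · rcases T.commute_or_fixed_or_cubic (map_notMem_fixed hg) hh with e | e | e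
        · have := φ.map_eq e
          rw [φ.map_map] at this
          exact absurd (e.trans (h4.symm.trans this.symm)) h5
        · rw [φ.map_map] at e
          exact absurd e h5
        · exact Or.inr (Or.inr (by simpa only [φ.map_map] using e.map_left))
    · rcases T.commute_or_fixed_or_cubic hg (map_notMem_fixed hh) with e | e | e
      · exact Or.inl (T.commute_of_commute_map hg hh h1 h2 e h4)
      · rw [φ.map_map] at e
        exact absurd e h4
      · exact Or.inr (Or.inr (by simpa only [φ.map_map] using e.map_right))
  · exact Or.inr (Or.inr e)

/-- Any two nonfixed elements commute or form a fixed pair. -/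
def SkewDichotomy (φ : GroupInvolution G) : Prop :=
  ∀ g, g ∉ φ.fixed → ∀ h, h ∉ φ.fixed → g * h = h * g ∨ φ.FixedPair g h

/-! ### No cubic pairs: an abelian subgroup of index two -/

/-- If `g` and `h` do not commute, `g * h` is fixed. Testing `x * g` against `h` shows that `x * g`
is fixed, while `x * (g * h)` is not because `x` is not; testing the latter against `g` gives a
contradiction. -/
theorem SkewDichotomy.commute_of_commute (N : φ.SkewDichotomy) {g h x : G} (hg : g ∉ φ.fixed)
    (hh : h ∉ φ.fixed) (hx : x ∉ φ.fixed) (xg : x * g = g * x) (xh : x * h = h * x) :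
    g * h = h * g := by
  by_contra hc
  obtain ⟨h1, h2, h3, h4⟩ := (N g hg h hh).resolve_left hc
  have xgh : x * (g * h) = g * h * x := by rw [← mul_assoc, xg, mul_assoc, xh, mul_assoc]
  have hxg : x * g = φ g * φ x := by
    by_contra hne
    have hxgn : x * g ∉ φ.fixed := by rwa [mul_mem_fixed_iff]
    rcases N _ hxgn h hh with e | ⟨e, -⟩
    · refine hc (mul_left_cancel (a := x) ?_)
      rw [← mul_assoc, e, ← mul_assoc, ← xh, mul_assoc]
    · rw [φ.map_mul, ← mul_assoc, ← h1, mul_assoc, xgh] at e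
      exact hx (mul_left_cancel e).symm
  have hw : x * (g * h) ∉ φ.fixed := by
    rw [mul_mem_fixed_iff, φ.map_mul, ← h1, xgh]
    exact fun e => hx (mul_left_cancel e).symm
  rcases N _ hw g hg with e | ⟨e, -⟩
  · refine hc (mul_left_cancel (a := x * g) ?_)
    calc x * g * (g * h) = g * (x * (g * h)) := by rw [xg, mul_assoc]
      _ = x * g * (h * g) := by rw [← e]; simp only [mul_assoc]
  · rw [φ.map_mul x, φ.map_mul g h, ← h1, xgh, mul_assoc, hxg, ← mul_assoc, ← mul_assoc] at e
    have e' := mul_right_cancel e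
    rw [h1, ← mul_assoc] at e'
    exact hc (by rw [h1, h2, mul_right_cancel e'])

/-- Only commuting `x`, `y` need work. Commuting is transitive on nonfixed elements, so some
nonfixed `k` commutes with none of `x`, `y` and (if it is nonfixed) `x * y`; the three resulting
fixed products force `φ k = k`. -/
theorem SkewDichotomy.mul_mem_fixed (N : φ.SkewDichotomy) {g h : G} (hg : g ∉ φ.fixed)
    (hh : h ∉ φ.fixed) (hc : g * h ≠ h * g) {x y : G} (hx : x ∉ φ.fixed) (hy : y ∉ φ.fixed) :
    x * y = φ y * φ x := by
  by_cases hxy : x * y = y * x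
  swap
  · exact ((N x hx y hy).resolve_left hxy).1
  by_contra hne
  have hn : x * y ∉ φ.fixed := by rwa [mul_mem_fixed_iff]
  obtain ⟨k, hk, hkx⟩ : ∃ k, k ∉ φ.fixed ∧ x * k ≠ k * x := by
    by_contra! H
    exact hc (N.commute_of_commute hg hh hx (H g hg) (H h hh))
  have hky : y * k ≠ k * y := fun e => hkx (N.commute_of_commute hx hk hy hxy.symm e)
  have hkxy : x * y * k ≠ k * (x * y) := fun e =>
    hkx (N.commute_of_commute hx hk hn (by rw [mul_assoc, ← hxy]) e)
  have e1 := ((N _ hn k hk).resolve_left hkxy).1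
  obtain ⟨e2, -⟩ := (N _ hy k hk).resolve_left hky
  obtain ⟨e3, -⟩ := (N _ hx k hk).resolve_left hkx
  rw [φ.map_mul, ← mul_assoc, ← e2, hxy, mul_assoc, mul_assoc, mul_right_inj, e3] at e1
  exact hk (mul_right_cancel e1)

/-- Elements outside `K` are fixed. For `f` outside `K`, so is `f * m` with `m ∈ K`, hence `φ` is
conjugation by `f` on `K`. A map that both preserves and reverses products makes `K` abelian. -/
theorem eq_top_of_not_commute {k l : G} (hk : k ∈ φ.nonfixedSubgroup)
    (hl : l ∈ φ.nonfixedSubgroup) (hc : k * l ≠ l * k) (f : G) : f ∈ φ.nonfixedSubgroup := by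
  by_contra hf
  have key : ∀ m ∈ φ.nonfixedSubgroup, f * m = φ m * f := by
    intro m hm
    have h1 : ∀ a, a ∉ φ.nonfixedSubgroup → φ a = a := fun a ha => by
      by_contra h
      exact ha (Subgroup.subset_closure h)
    have h2 := h1 (f * m) (fun h => hf ((Subgroup.mul_mem_cancel_right _ hm).mp h))
    rw [φ.map_mul, h1 f hf] at h2
    exact h2.symm
  have e := key (k * l) (mul_mem hk hl)
  rw [φ.map_mul, ← mul_assoc, key k hk, mul_assoc, key l hl, ← mul_assoc, mul_left_inj] at e
  have e' := φ.map_eq e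
  simp only [φ.map_map] at e'
  exact hc e'.symm

/-- If `x * y` and `z * w` do not commute, then `x * y * z` must be fixed: otherwise its product
with `w` is fixed by `P`, which says precisely that they commute. The same holds for the other
triples, and these relations end in `φ y = y`. -/
theorem mul_mem_fixed_four (P : ∀ x, x ∉ φ.fixed → ∀ y, y ∉ φ.fixed → x * y = φ y * φ x)
    {x y z w : G} (hx : x ∉ φ.fixed) (hy : y ∉ φ.fixed) (hz : z ∉ φ.fixed) (hw : w ∉ φ.fixed) :
    x * y * (z * w) = z * w * (x * y) := by
  have P' : ∀ x, x ∉ φ.fixed → ∀ y, y ∉ φ.fixed → x * φ y = y * φ x := fun x hx y hy => by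
    have := P x hx (φ y) (map_notMem_fixed hy)
    rwa [φ.map_map] at this
  have A : ∀ x, x ∉ φ.fixed → ∀ y, y ∉ φ.fixed → ∀ z, z ∉ φ.fixed → ∀ w, w ∉ φ.fixed →
      x * y * (z * w) ≠ z * w * (x * y) → x * y * z = φ z * (x * y) ∧ x * y * w = φ w * (x * y) := by
    intro x hx y hy z hz w hw hne
    have fxy : φ (x * y) = x * y := by rw [φ.map_mul, ← P x hx y hy]
    have h1 : x * y * z = φ z * (x * y) := by
      by_contra h
      have hn : x * y * z ∉ φ.fixed := by rwa [mul_mem_fixed_iff, fxy]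
      have := P _ hn w hw
      rw [φ.map_mul, fxy, ← mul_assoc, ← P z hz w hw, mul_assoc (x * y)] at this
      exact hne this
    refine ⟨h1, ?_⟩
    by_contra h
    have hn : x * y * w ∉ φ.fixed := by rwa [mul_mem_fixed_iff, fxy]
    have := P _ (map_notMem_fixed hz) _ hn
    rw [φ.map_mul, φ.map_map, fxy, ← mul_assoc, ← h1, mul_assoc (x * y),
      mul_assoc (φ w), h1, ← mul_assoc (φ w), ← P z hz w hw] at this
    exact hne this
  by_contra hne
  obtain ⟨hxyz, hxyw⟩ := A x hx y hy z hz w hw hne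
  obtain ⟨-, hzwy⟩ := A z hz w hw x hx y hy (Ne.symm hne)
  have hwy : w * w * y = y * (w * w) := by
    rw [mul_assoc, P w hw y hy, ← mul_assoc, P' w hw y hy, mul_assoc, ← P w hw w hw]
  have B : ∀ z, z ∉ φ.fixed → x * y * z = φ z * (x * y) → φ x = x * y * (z⁻¹ * y⁻¹ * z) := by
    intro z hz h
    refine mul_left_cancel (a := φ z) ?_
    rw [← P x hx z hz, ← mul_assoc, ← h]
    group
  have e : z⁻¹ * y⁻¹ * z = w⁻¹ * y⁻¹ * w :=
    mul_left_cancel ((B z hz hxyz).symm.trans (B w hw hxyw))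
  have e' : y * z * w⁻¹ = z * w⁻¹ * y := by
    have := congrArg (fun t => z * t⁻¹ * w⁻¹) e
    simpa [mul_assoc] using this
  -- Both `z * w⁻¹` and `w * w` commute with `y`, hence so does their product `z * w`.
  have hyzw : y * (z * w) = z * w * y := by
    calc y * (z * w) = y * z * w⁻¹ * (w * w) := by group
      _ = z * w⁻¹ * (w * w * y) := by rw [e', mul_assoc, hwy]
      _ = z * w * y := by group
  rw [← hyzw] at hzwy
  exact hy (mul_right_cancel hzwy).symm

/-- If `φ` satisfies the dichotomy and the subgroup generated by the nonfixed elements is not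
abelian, then the products of two nonfixed elements generate an abelian subgroup of index two. -/
theorem SkewDichotomy.exists_index_two (N : φ.SkewDichotomy) {k l : G}
    (hk : k ∈ φ.nonfixedSubgroup) (hl : l ∈ φ.nonfixedSubgroup) (hc : k * l ≠ l * k) :
    ∃ A : Subgroup G, A.index = 2 ∧ (∀ a ∈ A, ∀ b ∈ A, a * b = b * a) ∧ (A : Set G) ⊆ φ.fixed := by
  obtain ⟨g, hg, h, hh, hgh⟩ : ∃ g, g ∉ φ.fixed ∧ ∃ h, h ∉ φ.fixed ∧ g * h ≠ h * g := by
    by_contra! H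
    have : IsMulCommutative φ.nonfixedSubgroup :=
      Subgroup.isMulCommutative_closure fun a ha b hb => H a ha b hb
    exact hc (congrArg Subtype.val (mul_comm' (⟨k, hk⟩ : φ.nonfixedSubgroup) ⟨l, hl⟩))
  have P : ∀ x, x ∉ φ.fixed → ∀ y, y ∉ φ.fixed → x * y = φ y * φ x :=
    fun x hx y hy => N.mul_mem_fixed hg hh hgh hx hy
  let S : Set G := {a | ∃ x, x ∉ φ.fixed ∧ ∃ y, y ∉ φ.fixed ∧ a = x * y}
  have hS : ∀ x, x ∉ φ.fixed → ∀ y, y ∉ φ.fixed → x * y ∈ Subgroup.closure S :=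
    fun x hx y hy => Subgroup.subset_closure ⟨x, hx, y, hy, rfl⟩
  have hcomm : ∀ a ∈ Subgroup.closure S, ∀ b ∈ Subgroup.closure S, a * b = b * a := by
    have : IsMulCommutative (Subgroup.closure S) := by
      refine Subgroup.isMulCommutative_closure ?_
      rintro _ ⟨x, hx, y, hy, rfl⟩ _ ⟨z, hz, w, hw, rfl⟩
      exact mul_mem_fixed_four P hx hy hz hw
    exact fun a ha b hb => congrArg Subtype.val (mul_comm' (⟨a, ha⟩ : Subgroup.closure S) ⟨b, hb⟩)
  have hfix : (Subgroup.closure S : Set G) ⊆ φ.fixed := by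
    intro a ha
    induction ha using Subgroup.closure_induction with
    | mem a ha =>
      obtain ⟨x, hx, y, hy, rfl⟩ := ha
      exact mul_mem_fixed_iff.mpr (P x hx y hy)
    | one => exact φ.map_one
    | mul a b ha hb ha' hb' =>
      rw [mul_mem_fixed_iff, mem_fixed.mp ha', mem_fixed.mp hb', hcomm a ha b hb]
    | inv a ha ha' => rw [mem_fixed, φ.map_inv, mem_fixed.mp ha']
  refine ⟨Subgroup.closure S, Subgroup.index_eq_two_iff.mpr ⟨g, fun b => ?_⟩, hcomm, hfix⟩
  -- Since `K` is all of `G`, `b` is a word in nonfixed elements; words of even length lie in the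
  -- closure, words of odd length do so after appending `g`.
  have hor : b ∈ Subgroup.closure S ∨ b * g ∈ Subgroup.closure S := by
    have step : ∀ a, (a ∈ Subgroup.closure S ∨ a * g ∈ Subgroup.closure S) → ∀ x, x ∉ φ.fixed →
        (a * x ∈ Subgroup.closure S ∨ a * x * g ∈ Subgroup.closure S) := by
      rintro a (ha | ha) x hx
      · right
        rw [mul_assoc]
        exact mul_mem ha (hS x hx g hg)
      · left
        have := mul_mem ha (hS g⁻¹ (inv_notMem_fixed hg) x hx)
        rwa [← mul_assoc, mul_inv_cancel_right] at this
    have hb := eq_top_of_not_commute hk hl hc b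
    induction hb using Subgroup.closure_induction_right with
    | one => exact Or.inl (one_mem _)
    | mul_right a _ x hx ih => exact step a ih x hx
    | mul_inv_cancel a _ x hx ih => exact step a ih x⁻¹ (inv_notMem_fixed hx)
  have hnot : ¬(b * g ∈ Subgroup.closure S ∧ b ∈ Subgroup.closure S) := fun ⟨h1, h2⟩ =>
    hg (hfix ((Subgroup.mul_mem_cancel_left _ h2).mp h1))
  rcases hor with h | h
  · exact Or.inr ⟨h, fun h' => hnot ⟨h', h⟩⟩
  · exact Or.inl ⟨h, fun h' => hnot ⟨h, h'⟩⟩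

/-! ### A cubic pair yields a central element of order three -/

/-- The element `t` hidden in the cubic pair satisfies `r = t` or `r = t²`, so `r` can replace it.
This lets different pairs share one `s`. -/
theorem CubicPair.of_map_eq {x k r : G} (H : φ.CubicPair x k) (hr : φ k = r * k) :
    x * r = r * x ∧ (φ x = r * x ∨ φ x = r * (r * x)) := by
  obtain ⟨t, t3, -, xt, -, -, hx, hk⟩ := H
  rcases hk with e | e
  · obtain rfl : r = t := mul_right_cancel (hr.symm.trans e)
    exact ⟨xt, hx⟩
  · obtain rfl : r = t * t := mul_right_cancel (hr.symm.trans (e.trans (mul_assoc _ _ _).symm))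
    refine ⟨by simp only [mul_assoc, xt, reassoc xt], ?_⟩
    simp only [mul_assoc, reassoc₃ t3, one_mul]
    exact hx.symm

/-- In a fixed pair `x` inverts `s`, in a cubic pair it centralises `s`; order three does not allow
both. -/
theorem false_of_mul_mul_eq {s x : G} (s3 : s * (s * s) = 1) (s1 : s ≠ 1) (h1 : s * (x * s) = x)
    (h2 : x * s = s * x) : False := by
  rw [h2, ← mul_assoc, mul_eq_right] at h1
  rw [h1, mul_one] at s3
  exact s1 s3

theorem FixedPair.of_map_eq {x g s : G} (H : φ.FixedPair x g)
    (hg : φ g = s * g) :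
    s * (x * s) = x ∧ g * x = φ x * s * g ∧ g * φ x = x * s * g := by
  obtain ⟨h1, h2, h3, h4⟩ := H
  rw [hg] at h1 h2 h3
  refine ⟨mul_right_cancel (b := g) ?_, by rw [h2, mul_assoc], by rw [← h3, mul_assoc]⟩
  rw [h1]
  simp only [mul_assoc, ← h3]

/-- Each two nonfixed elements commute, form a fixed pair, or form a cubic pair. -/
def PairTrichotomy (φ : GroupInvolution G) : Prop :=
  ∀ g, g ∉ φ.fixed → ∀ h, h ∉ φ.fixed → g * h = h * g ∨ φ.FixedPair g h ∨ φ.CubicPair g h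

/-- Here `x` inverts `s`, and is tested against `φ h`, which `φ` multiplies by `s²`. Commuting or a
cubic pair makes `x` centralise `s`; a fixed pair gives `φ x = s * x`, so that `x` commutes with
`g`. -/
theorem PairTrichotomy.false_of_fixedPair_of_commute (T : φ.PairTrichotomy) {s g h x : G}
    (s3 : s * (s * s) = 1) (s1 : s ≠ 1)
    (hg : φ g = s * g) (hh : φ h = s * h) (hhn : h ∉ φ.fixed) (hx : x ∉ φ.fixed)
    (hF : φ.FixedPair x g) (hc : x * g ≠ g * x) (hxh : x * h = h * x) : False := by
  obtain ⟨a1, a2, -⟩ := hF.of_map_eq hg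
  have hh2 : φ (φ h) = s * s * φ h := by
    rw [φ.map_map, hh, mul_assoc, reassoc₃ s3, one_mul]
  rcases T x hx _ (map_notMem_fixed hhn) with e | e | e
  · refine false_of_mul_mul_eq s3 s1 a1 (mul_right_cancel (b := h) ?_)
    rw [mul_assoc, ← hh, e, hh, mul_assoc, mul_assoc, hxh]
  · obtain ⟨-, b, -⟩ := e.of_map_eq hh2
    rw [hh, mul_assoc, ← hxh, mul_assoc] at b
    have b' : s * x = φ x := mul_right_cancel (b := h) (by
      rw [mul_assoc, b]
      simp only [mul_assoc, reassoc₃ s3, one_mul])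
    rw [← b', mul_assoc s, a1] at a2
    exact hc a2.symm
  · refine false_of_mul_mul_eq s3 s1 a1 ?_
    obtain ⟨c, -⟩ := e.of_map_eq hh2
    rw [eq_inv_of_mul_eq_one_right s3] at c
    exact (Commute.inv_right_iff.mp c).eq

/-- Now the test element is `g * h`, which `φ` also multiplies by `s`. -/
theorem PairTrichotomy.false_of_fixedPair_of_fixedPair (T : φ.PairTrichotomy) {s g h x : G}
    (s3 : s * (s * s) = 1) (s1 : s ≠ 1) (gs : g * s = s * g) (hs : h * s = s * h)
    (gh : g * h = s * (h * g))
    (hg : φ g = s * g) (hh : φ h = s * h) (hx : x ∉ φ.fixed)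
    (hF : φ.FixedPair x g) (hF' : φ.FixedPair x h) : False := by
  obtain ⟨a1, a2, a3⟩ := hF.of_map_eq hg
  obtain ⟨-, b2, b3⟩ := hF'.of_map_eq hh
  have hgh : φ (g * h) = s * (g * h) := by
    rw [φ.map_mul, hg, hh, gh]
    simp only [mul_assoc, reassoc hs]
  have ghs : g * h * s = s * (g * h) := by
    simp only [mul_assoc, hs, reassoc gs]
  have ghx : g * h * x = x * (s * s) * (g * h) := by
    rw [mul_assoc, b2, mul_assoc, ← mul_assoc, a3]
    simp only [mul_assoc, reassoc gs]
  have hne : g * h ∉ φ.fixed := fun e => s1 (by rwa [mem_fixed, hgh, mul_eq_right] at e)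
  rcases T x hx _ hne with e | e | e
  · rw [ghx, mul_left_inj, left_eq_mul] at e
    rw [e, mul_one] at s3
    exact s1 s3
  · obtain ⟨-, c, -⟩ := e.of_map_eq hgh
    rw [ghx, mul_left_inj, ← mul_assoc, mul_left_inj] at c
    rw [← c] at a3
    rw [← c] at a2
    rw [← mul_assoc, a2] at a3
    simp only [mul_assoc, gs, mul_right_inj, reassoc₃ s3, one_mul] at a3
    exact s1 (mul_eq_right.mp a3.symm)
  · exact false_of_mul_mul_eq s3 s1 a1 (e.of_map_eq hgh).1

theorem PairTrichotomy.not_fixedPair (T : φ.PairTrichotomy) {s g h x : G}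
    (s3 : s * (s * s) = 1) (s1 : s ≠ 1) (gs : g * s = s * g) (hs : h * s = s * h)
    (gh : g * h = s * (h * g)) (hg : φ g = s * g) (hh : φ h = s * h)
    (hgn : g ∉ φ.fixed) (hhn : h ∉ φ.fixed) (hx : x ∉ φ.fixed) :
    (x * g = g * x ∨ φ.CubicPair x g) ∧ (x * h = h * x ∨ φ.CubicPair x h) := by
  by_cases c1 : x * g = g * x <;> by_cases c2 : x * h = h * x
  · exact ⟨Or.inl c1, Or.inl c2⟩
  · refine ⟨Or.inl c1, Or.inr ?_⟩
    rcases (T x hx h hhn).resolve_left c2 with e | e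
    · exact (T.false_of_fixedPair_of_commute s3 s1 hh hg hgn hx e c2 c1).elim
    · exact e
  · refine ⟨Or.inr ?_, Or.inl c2⟩
    rcases (T x hx g hgn).resolve_left c1 with e | e
    · exact (T.false_of_fixedPair_of_commute s3 s1 hg hh hhn hx e c1 c2).elim
    · exact e
  · rcases (T x hx g hgn).resolve_left c1 with e | e <;>
      rcases (T x hx h hhn).resolve_left c2 with e' | e'
    · exact (T.false_of_fixedPair_of_fixedPair s3 s1 gs hs gh hg hh hx e e').elim
    · exact (false_of_mul_mul_eq s3 s1 (e.of_map_eq hg).1 (e'.of_map_eq hh).1).elim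
    · exact (false_of_mul_mul_eq s3 s1 (e'.of_map_eq hh).1 (e.of_map_eq hg).1).elim
    · exact ⟨Or.inr e, Or.inr e'⟩

/-- If `x` forms a cubic pair with `g` or `h`, `CubicPair.of_map_eq` applies. If `x` commutes with
both, it commutes with their commutator `s`, and `x * g` is used instead: either it is fixed, or it
fails to commute with `h` and so forms a cubic pair with `h`. Both determine `φ x`. -/
theorem PairTrichotomy.map_eq_of_notMem_fixed (T : φ.PairTrichotomy) {s g h x : G}
    (s3 : s * (s * s) = 1) (s1 : s ≠ 1) (gs : g * s = s * g) (hs : h * s = s * h)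
    (gh : g * h = s * (h * g)) (hg : φ g = s * g) (hh : φ h = s * h)
    (hgn : g ∉ φ.fixed) (hhn : h ∉ φ.fixed) (hx : x ∉ φ.fixed) :
    x * s = s * x ∧ (φ x = s * x ∨ φ x = s * (s * x)) := by
  have D := fun x hx => T.not_fixedPair (x := x) s3 s1 gs hs gh hg hh hgn hhn hx
  obtain ⟨c1 | c1, c2 | c2⟩ := D x hx
  · have xs : x * s = s * x := mul_right_cancel (b := h * g) (by
      rw [mul_assoc, ← gh, ← mul_assoc, c1, mul_assoc, c2, ← mul_assoc, gh]
      simp only [mul_assoc, ← c1, reassoc c2])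
    refine ⟨xs, ?_⟩
    by_cases hf : x * g ∈ φ.fixed
    · rw [mul_mem_fixed_iff, hg, c1, ← gs, mul_assoc, mul_right_inj] at hf
      right
      conv_rhs => rw [hf, reassoc₃ s3, one_mul]
    · rcases (D _ hf).2 with e | e
      · exfalso
        rw [← mul_assoc, ← c2, mul_assoc, mul_assoc, mul_right_inj, gh] at e
        exact s1 (mul_eq_right.mp e)
      · have := (e.of_map_eq hh).2
        rw [φ.map_mul, hg, c1] at this
        simp only [mul_assoc, mul_right_inj] at this
        rcases this with e | e
        · exact absurd e hx
        · left
          rw [← mul_assoc, ← gs, mul_assoc, mul_right_inj] at e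
          exact e
  · exact c2.of_map_eq hh
  · exact c1.of_map_eq hg
  · exact c1.of_map_eq hg

/-- If `f * g` or `f * h` is nonfixed, it centralises `s`, and so does `f`. Otherwise `f` conjugates
`g` to `s * g` and `h` to `s * h`, which preserves their commutator `s`. -/
theorem PairTrichotomy.commute_of_mem_fixed (T : φ.PairTrichotomy) {s g h f : G}
    (s3 : s * (s * s) = 1) (s1 : s ≠ 1) (gs : g * s = s * g) (hs : h * s = s * h)
    (gh : g * h = s * (h * g)) (hg : φ g = s * g) (hh : φ h = s * h)
    (hgn : g ∉ φ.fixed) (hhn : h ∉ φ.fixed) (hf : f ∈ φ.fixed) :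
    f * s = s * f := by
  have D := fun x hx => T.map_eq_of_notMem_fixed (x := x) s3 s1 gs hs gh hg hh hgn hhn hx
  by_cases h1 : f * g ∈ φ.fixed
  · by_cases h2 : f * h ∈ φ.fixed
    · rw [mul_mem_fixed_iff, hg, mem_fixed.mp hf] at h1
      rw [mul_mem_fixed_iff, hh, mem_fixed.mp hf] at h2
      rw [mul_assoc] at h1 h2
      refine mul_right_cancel (b := h * g) ?_
      calc f * s * (h * g) = f * (g * h) := by rw [mul_assoc, gh]
        _ = s * (g * (s * (h * f))) := by rw [reassoc h1, mul_assoc, mul_assoc, h2]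
        _ = s * f * (h * g) := by
          simp only [mul_assoc, reassoc h2, h1, reassoc gs, reassoc hs, reassoc gh]
    · have := (D _ h2).1
      rw [mul_assoc, hs, ← mul_assoc, ← mul_assoc] at this
      exact mul_right_cancel this
  · have := (D _ h1).1
    rw [mul_assoc, gs, ← mul_assoc, ← mul_assoc] at this
    exact mul_right_cancel this

theorem PairTrichotomy.exists_of_cubicPair (T : φ.PairTrichotomy) {g h : G}
    (hgn : g ∉ φ.fixed) (hhn : h ∉ φ.fixed) (H : φ.CubicPair g h) :
    ∃ s : G, s * (s * s) = 1 ∧ s ≠ 1 ∧ (∃ g h, g * h = s * (h * g)) ∧ (∀ a, a * s = s * a) ∧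
      ∀ a, φ a = a ∨ φ a = s * a ∨ φ a = s * (s * a) := by
  have main : ∀ s g h : G, g ∉ φ.fixed → h ∉ φ.fixed → s * (s * s) = 1 → s ≠ 1 → g * s = s * g →
      h * s = s * h → g * h = s * (h * g) → φ g = s * g → φ h = s * h →
      ∃ s : G, s * (s * s) = 1 ∧ s ≠ 1 ∧ (∃ g h, g * h = s * (h * g)) ∧ (∀ a, a * s = s * a) ∧
      ∀ a, φ a = a ∨ φ a = s * a ∨ φ a = s * (s * a) := by
    intro s g h hgn hhn s3 s1 gs hs gh hg hh
    refine ⟨s, s3, s1, ⟨g, h, gh⟩, fun a => ?_, fun a => ?_⟩ <;> by_cases ha : a ∈ φ.fixed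
    · exact T.commute_of_mem_fixed s3 s1 gs hs gh hg hh hgn hhn ha
    · exact (T.map_eq_of_notMem_fixed s3 s1 gs hs gh hg hh hgn hhn ha).1
    · exact Or.inl ha
    · exact Or.inr (T.map_eq_of_notMem_fixed s3 s1 gs hs gh hg hh hgn hhn ha).2
  -- Replacing an entry by its image under `φ` normalises its multiplier to `s`, without changing
  -- the commutator.
  have flip : ∀ s a : G, s * (s * s) = 1 → φ a = s * (s * a) → φ (φ a) = s * φ a := by
    intro s a s3 ha
    rw [φ.map_map, ha, reassoc₃ s3, one_mul]
  obtain ⟨s, s3, s1, gs, hs, gh, hg, hh⟩ := H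
  rcases hg with hg | hg <;> rcases hh with hh | hh
  · exact main s g h hgn hhn s3 s1 gs hs gh hg hh
  · refine main s g (φ h) hgn (map_notMem_fixed hhn) s3 s1 gs ?_ ?_ hg (flip s h s3 hh) <;>
      simp only [hh, mul_assoc, hs, reassoc gs, gh]
  · refine main s (φ g) h (map_notMem_fixed hgn) hhn s3 s1 ?_ hs ?_ (flip s g s3 hg) hh <;>
      simp only [hg, mul_assoc, gs, reassoc hs, gh]
  · refine main s (φ g) (φ h) (map_notMem_fixed hgn) (map_notMem_fixed hhn) s3 s1 ?_ ?_ ?_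
      (flip s g s3 hg) (flip s h s3 hh) <;>
      simp only [hg, hh, mul_assoc, gs, hs, reassoc gs, reassoc hs, gh]

/-! ### Nonzero two-torsion: a central element of order two -/

/-- For noncommuting nonfixed `g`, `h`, the product `g * h` cannot be fixed, by `B` applied to `g *
h` and `h`; so the last alternative of `Q` holds and the commutator `s` is an involution with `φ g =
s * g`, `φ h = s * h`. The pair `k`, `l` fixes one `s`. A nonfixed `x` commuting with both is
handled through `x * k`, a fixed one through `B`. -/
theorem exists_central_of_not_commute
    (Q : ∀ g, g ∉ φ.fixed → ∀ h, h ∉ φ.fixed → g * h = h * g ∨ g * h = φ h * φ g ∨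
      (g * h = φ g * φ h ∧ g * h = h * φ g ∧ g * h = φ h * g))
    (B : ∀ f ∈ φ.fixed, ∀ g, g ∉ φ.fixed → f * g = g * f ∨ (f * g = φ g * f ∧ f * φ g = g * f))
    {k l : G} (hkn : k ∉ φ.fixed) (hln : l ∉ φ.fixed) (hkl : k * l ≠ l * k) :
    ∃ s : G, s * s = 1 ∧ s ≠ 1 ∧ (∃ g h, g * h = s * (h * g)) ∧ (∀ a, a * s = s * a) ∧
      ∀ a, φ a = a ∨ φ a = s * a := by
  have pair : ∀ g, g ∉ φ.fixed → ∀ h, h ∉ φ.fixed → g * h ≠ h * g →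
      ∃ s : G, s * s = 1 ∧ g * h = s * (h * g) ∧ g * s = s * g ∧ h * s = s * h ∧ φ g = s * g ∧
        φ h = s * h := by
    intro g hg h hh hc
    rcases Q g hg h hh with e | e | ⟨e1, e2, e3⟩
    · exact absurd e hc
    · exfalso
      have hf := mul_mem_fixed_iff.mpr e
      rcases B _ hf h hh with e' | ⟨e', -⟩
      · exact hc (mul_right_cancel (e'.trans (mul_assoc _ _ _).symm))
      · rw [← mul_assoc] at e'
        exact hg (mul_left_cancel ((e.symm.trans (mul_right_cancel e'))))
    · obtain ⟨s, hs⟩ : ∃ s, g * h = s * (h * g) := ⟨g * h * (h * g)⁻¹, by group⟩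
      have e1' := φ.map_eq e1
      have e2' := φ.map_eq e2
      have e3' := φ.map_eq e3
      simp only [φ.map_map] at e1' e2' e3'
      have h1 : φ h = s * h := mul_right_cancel (b := g) (by rw [← e3, hs, mul_assoc])
      have h2 : φ g = g * s := mul_right_cancel (b := h) (by rw [← e3', e2', h1, mul_assoc])
      have h3 : g = s * φ g := mul_right_cancel (b := h) (by rw [mul_assoc, ← e3', e1', hs])
      have h4 : φ g * s = g := mul_right_cancel (b := h) (by rw [mul_assoc, ← h1, ← e1])
      have h5 : s * s = 1 := by
        rwa [h2, mul_assoc, mul_eq_left] at h4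
      have h6 : φ g = s * g := by
        conv_rhs => rw [h3, ← mul_assoc, h5, one_mul]
      refine ⟨s, h5, hs, h2.symm.trans h6, ?_, h6, h1⟩
      exact mul_right_cancel (b := g) (by rw [mul_assoc, ← h6, ← e2, hs, mul_assoc])
  obtain ⟨s, s2, kl, ks, ls, hk, hl⟩ := pair k hkn l hln hkl
  have s1 : s ≠ 1 := fun e => hkl (by rw [kl, e, one_mul])
  have tri : ∀ x, x ∉ φ.fixed → ∀ g, g ∉ φ.fixed → φ g = s * g → x * g ≠ g * x →
      x * s = s * x ∧ φ x = s * x := by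
    intro x hx g hg e hc
    obtain ⟨t, -, -, xt, -, h1, h2⟩ := pair x hx g hg hc
    obtain rfl : s = t := mul_right_cancel (e.symm.trans h2)
    exact ⟨xt, h1⟩
  have main : ∀ x, x ∉ φ.fixed → x * s = s * x ∧ φ x = s * x := by
    intro x hx
    by_cases c1 : x * k = k * x
    swap
    · exact tri x hx k hkn hk c1
    by_cases c2 : x * l = l * x
    swap
    · exact tri x hx l hln hl c2
    have xs : x * s = s * x := mul_right_cancel (b := l * k) (by
      rw [mul_assoc, ← kl, ← mul_assoc, c1, mul_assoc, c2, ← mul_assoc, kl]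
      simp only [mul_assoc, ← c1, reassoc c2])
    refine ⟨xs, ?_⟩
    by_cases hf : x * k ∈ φ.fixed
    · rw [mul_mem_fixed_iff, hk, c1, ← ks, mul_assoc, mul_right_inj] at hf
      conv_rhs => rw [hf, ← mul_assoc, s2, one_mul]
    · by_cases c3 : x * k * l = l * (x * k)
      · exfalso
        rw [← mul_assoc, ← c2, mul_assoc, mul_assoc, mul_right_inj] at c3
        exact hkl c3
      · exfalso
        have := (tri _ hf l hln hl c3).2
        rw [φ.map_mul, hk, c1] at this
        simp only [mul_assoc, mul_right_inj] at this
        exact hx this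
  refine ⟨s, s2, s1, ⟨k, l, kl⟩, fun a => ?_, fun a => ?_⟩ <;> by_cases ha : a ∈ φ.fixed
  · refine mul_right_cancel (b := k) ?_
    rcases B a ha k hkn with e | ⟨e1, e2⟩
    · have e' := φ.map_eq e
      rw [mem_fixed.mp ha, hk] at e'
      rw [mul_assoc, ← e', mul_assoc, mul_assoc, e]
    · rw [hk] at e1 e2
      rw [mul_assoc, e2, mul_assoc, e1, mul_assoc, ← mul_assoc s, s2, one_mul]
  · exact (main a ha).1
  · exact Or.inl ha
  · exact Or.inr (main a ha).2

/-! ### The derived subgroup -/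

/-- Modulo the central subgroup `⟨s⟩` the map `φ` is the identity, and an identity map that reverses
products makes the quotient abelian. -/
theorem commutator_eq_zpowers {s : G} (hs : ∀ a, a * s = s * a)
    (hφ : ∀ a, φ a * a⁻¹ ∈ Subgroup.zpowers s) (hgh : ∃ g h, g * h = s * (h * g)) :
    commutator G = Subgroup.zpowers s ∧ φ.onQuotient.fixed = Set.univ := by
  have hc : ∀ n ∈ Subgroup.zpowers s, ∀ a, a * n = n * a := by
    rintro _ ⟨k, rfl⟩ a
    exact (Commute.zpow_right (hs a) k)
  have h1 : commutator G = Subgroup.zpowers s := by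
    apply le_antisymm
    · rw [commutator_def, Subgroup.commutator_le]
      intro a _ b _
      obtain ⟨m, hm, ha⟩ : ∃ m ∈ Subgroup.zpowers s, φ a = m * a := ⟨_, hφ a, by group⟩
      obtain ⟨n, hn, hb⟩ : ∃ n ∈ Subgroup.zpowers s, φ b = n * b := ⟨_, hφ b, by group⟩
      obtain ⟨p, hp, hab⟩ : ∃ p ∈ Subgroup.zpowers s, φ (b * a) = p * (b * a) :=
        ⟨_, hφ (b * a), by group⟩
      rw [φ.map_mul, ha, hb, mul_assoc, ← mul_assoc a, hc n hn, mul_assoc, ← mul_assoc m] at hab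
      have : ⁅a, b⁆ = (m * n)⁻¹ * p := by
        rw [commutatorElement_def, eq_inv_mul_iff_mul_eq]
        calc m * n * (a * b * a⁻¹ * b⁻¹) = m * n * (a * b) * (a⁻¹ * b⁻¹) := by
              simp only [mul_assoc]
          _ = p := by rw [hab]; group
      rw [this]
      exact mul_mem (inv_mem (mul_mem hm hn)) hp
    · obtain ⟨g, h, e⟩ := hgh
      rw [Subgroup.zpowers_le]
      have : s = ⁅g, h⁆ := by
        rw [commutatorElement_def, e]
        group
      rw [this, commutator_def]
      exact Subgroup.commutator_mem_commutator (Subgroup.mem_top _) (Subgroup.mem_top _)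
  refine ⟨h1, Set.eq_univ_of_forall ?_⟩
  rintro ⟨a⟩
  refine (QuotientGroup.eq (s := commutator G)).mpr ?_
  have := hφ a
  rw [← h1] at this
  have := inv_mem (Subgroup.Normal.conj_mem inferInstance _ this a⁻¹)
  simpa [mul_assoc] using this

theorem mul_inv_mem_commutator (hq : φ.onQuotient.fixed = Set.univ) (a : G) :
    φ a * a⁻¹ ∈ commutator G := by
  have h : φ.onQuotient (a : G ⧸ commutator G) = a := by
    have : (a : G ⧸ commutator G) ∈ φ.onQuotient.fixed := hq ▸ Set.mem_univ _
    exact this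
  have h2 := (QuotientGroup.eq (s := commutator G) (a := φ a) (b := a)).mp h
  have := inv_mem (Subgroup.Normal.conj_mem inferInstance _ h2 a)
  simpa [mul_assoc] using this

theorem mul_mul_inv_mem_commutator (a b : G) : a * b * (b * a)⁻¹ ∈ commutator G := by
  have : a * b * (b * a)⁻¹ = ⁅a, b⁆ := by rw [commutatorElement_def]; group
  rw [this, commutator_def]
  exact Subgroup.commutator_mem_commutator (Subgroup.mem_top _) (Subgroup.mem_top _)

theorem exists_central_of_card_two (h2 : Nat.card (commutator G) = 2)
    (hq : φ.onQuotient.fixed = Set.univ) :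
    ∃ s : G, s * s = 1 ∧ (∀ a, a * s = s * a) ∧ (∀ a b, a * b = b * a ∨ a * b = s * (b * a)) ∧
      ∀ a, φ a = a ∨ φ a = s * a := by
  obtain ⟨⟨s, hs⟩, hs1, hu⟩ := (Nat.card_eq_two_iff' (1 : commutator G)).mp h2
  have hs1' : s ≠ 1 := fun e => hs1 (Subtype.ext e)
  have D : ∀ t ∈ commutator G, t = 1 ∨ t = s := by
    intro t ht
    by_cases h : t = 1
    · exact Or.inl h
    · exact Or.inr (congrArg Subtype.val (hu ⟨t, ht⟩ (fun e => h (congrArg Subtype.val e))))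
  have D' : ∀ a b, a * b⁻¹ ∈ commutator G → a = b ∨ a = s * b := by
    intro a b hab
    rcases D _ hab with e | e
    · exact Or.inl (mul_inv_eq_one.mp e)
    · exact Or.inr (mul_inv_eq_iff_eq_mul.mp e)
  refine ⟨s, ?_, fun a => ?_, fun a b => D' _ _ (mul_mul_inv_mem_commutator a b),
    fun a => D' _ _ (mul_inv_mem_commutator hq a)⟩
  · rcases D _ (mul_mem hs hs) with e | e
    · exact e
    · exact absurd (mul_eq_left.mp e) hs1'
  · rcases D _ (Subgroup.Normal.conj_mem inferInstance _ hs a) with e | e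
    · exact absurd (by simpa using e) hs1'
    · exact mul_inv_eq_iff_eq_mul.mp e

theorem exists_of_card_three (h3 : Nat.card (commutator G) = 3)
    (hq : φ.onQuotient.fixed = Set.univ) (hcube : ∀ g : G, g ^ 3 ∈ φ.fixed) :
    ∃ s : G, s * (s * s) = 1 ∧ (∀ a b, a * b = b * a ∨ a * b = s * (b * a) ∨ a * b = s * s * (b * a)) ∧
      ∀ a, a ∉ φ.fixed → a * s = s * a ∧ (φ a = s * a ∨ φ a = s * s * a) := by
  have : Nontrivial (commutator G) := by
    have : Finite (commutator G) := Nat.finite_of_card_ne_zero (by omega)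
    exact Finite.one_lt_card_iff_nontrivial.mp (by omega)
  obtain ⟨⟨s, hs⟩, hs1⟩ := exists_ne (1 : commutator G)
  have hs1' : s ≠ 1 := fun e => hs1 (Subtype.ext e)
  have s3 : s * (s * s) = 1 := by
    have := pow_card_eq_one' (x := (⟨s, hs⟩ : commutator G))
    rw [h3] at this
    have := congrArg Subtype.val this
    rw [← mul_assoc]
    simpa [pow_succ] using this
  have D : ∀ t ∈ commutator G, t = 1 ∨ t = s ∨ t = s * s := by
    have ho : orderOf s = 3 := orderOf_eq_prime (by rw [← s3, pow_succ, pow_two, mul_assoc]) hs1'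
    have he : Subgroup.zpowers s = commutator G := by
      have : Finite (commutator G) := Nat.finite_of_card_ne_zero (by omega)
      refine Subgroup.eq_of_le_of_card_ge (by rwa [Subgroup.zpowers_le]) ?_
      rw [h3, Nat.card_zpowers, ho]
    intro t ht
    rw [← he, Subgroup.mem_zpowers_iff] at ht
    obtain ⟨k, rfl⟩ := ht
    have hk : s ^ k = s ^ (k % 3) := by
      have := zpow_mod_orderOf s k
      rw [ho] at this
      exact this.symm
    rw [hk]
    have : k % 3 = 0 ∨ k % 3 = 1 ∨ k % 3 = 2 := by omega
    rcases this with e | e | e <;> rw [e]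
    · exact Or.inl (zpow_zero _)
    · exact Or.inr (Or.inl (zpow_one _))
    · exact Or.inr (Or.inr (zpow_two _))
  have D' : ∀ a b, a * b⁻¹ ∈ commutator G → a = b ∨ a = s * b ∨ a = s * s * b := by
    intro a b hab
    rcases D _ hab with e | e | e
    · exact Or.inl (mul_inv_eq_one.mp e)
    · exact Or.inr (Or.inl (mul_inv_eq_iff_eq_mul.mp e))
    · exact Or.inr (Or.inr (mul_inv_eq_iff_eq_mul.mp e))
  refine ⟨s, s3, fun a b => D' _ _ (mul_mul_inv_mem_commutator a b), fun a ha => ?_⟩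
  have h1 := (D' _ _ (mul_inv_mem_commutator hq a)).resolve_left ha
  refine ⟨?_, h1⟩
  rcases D _ (Subgroup.Normal.conj_mem inferInstance _ hs a) with e | e | e
  · exact absurd (by simpa using e) hs1'
  · exact mul_inv_eq_iff_eq_mul.mp e
  -- If `a` inverted `s`, then `φ (a³)` would be `a³` times a nontrivial power of `s`, against the
  -- cube condition.
  · exfalso
    have as : a * s = s * (s * a) := by
      rw [← mul_assoc]
      exact mul_inv_eq_iff_eq_mul.mp e
    have hc := hcube a
    rw [pow_succ, pow_two, mul_assoc, mem_fixed, φ.map_mul, φ.map_mul] at hc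
    rcases h1 with e | e <;> rw [e] at hc <;>
      simp only [mul_assoc, reassoc as, reassoc₃ s3, one_mul] at hc
    · exact hs1' (mul_eq_right.mp hc)
    · rw [← mul_assoc s s, mul_eq_right] at hc
      rw [hc, mul_one] at s3
      exact hs1' s3

/-! ### The structure of `G` when `K` is abelian -/

theorem exists_map_eq_conj (hG : ∃ g h : G, g * h ≠ h * g)
    (hK : ∀ k ∈ φ.nonfixedSubgroup, ∀ l ∈ φ.nonfixedSubgroup, k * l = l * k) :
    ∃ x ∈ φ.fixed, x ∉ φ.nonfixedSubgroup ∧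
      (∀ g : G, g ∈ φ.nonfixedSubgroup ∨ ∃ k ∈ φ.nonfixedSubgroup, g = k * x) ∧
      ∀ x, x ∉ φ.nonfixedSubgroup → ∀ k ∈ φ.nonfixedSubgroup, φ k = x * k * x⁻¹ := by
  have h1 : ∀ a, a ∉ φ.nonfixedSubgroup → φ a = a := fun a ha => by
    by_contra h
    exact ha (Subgroup.subset_closure h)
  have h2 : ∀ x, x ∉ φ.nonfixedSubgroup → ∀ k ∈ φ.nonfixedSubgroup, φ k = x * k * x⁻¹ := by
    intro x hx k hk
    have := h1 (x * k) (fun h => hx ((Subgroup.mul_mem_cancel_right _ hk).mp h))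
    rw [φ.map_mul, h1 x hx] at this
    exact eq_mul_inv_of_mul_eq this
  obtain ⟨x, hx⟩ : ∃ x, x ∉ φ.nonfixedSubgroup := by
    by_contra! H
    obtain ⟨g, h, hgh⟩ := hG
    exact hgh (hK g (H g) h (H h))
  refine ⟨x, h1 x hx, hx, fun g => ?_, h2⟩
  by_cases hg : g ∈ φ.nonfixedSubgroup
  · exact Or.inl hg
  refine Or.inr ⟨g * x⁻¹, ?_, by group⟩
  by_contra hgx
  obtain ⟨a, b, hab⟩ := hG
  -- If `g` and `g * x⁻¹` both lay outside `K`, conjugation by `g * x⁻¹`, by `x⁻¹` and by `g` would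
  -- all equal `φ` on `K`. Then `φ = φ ∘ φ = id` there, so `φ` is the identity on `G` and `G` is
  -- abelian.
  have hfix : ∀ k, φ k = k := by
    intro k
    by_cases hk : k ∈ φ.nonfixedSubgroup
    · have hgx' : g⁻¹ ∉ φ.nonfixedSubgroup := fun h => hg (inv_mem_iff.mp h)
      have hxi : x⁻¹ ∉ φ.nonfixedSubgroup := fun h => hx (inv_mem_iff.mp h)
      have hφk : φ k ∈ φ.nonfixedSubgroup := by
        by_contra h
        have := h1 _ h
        rw [φ.map_map] at this
        exact h (this ▸ hk)
      have e1 := h2 _ hgx k hk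
      have e2 := h2 _ hxi k hk
      have e3 := h2 _ hg _ hφk
      rw [φ.map_map] at e3
      calc φ k = g * (x⁻¹ * k * x⁻¹⁻¹) * g⁻¹ := by rw [e1]; group
        _ = g * φ k * g⁻¹ := by rw [← e2]
        _ = k := e3.symm
    · exact h1 k hk
  exact hab (by have := φ.map_mul a b; rwa [hfix, hfix, hfix] at this)

/-! ### Sufficiency of the four conditions -/

/-- The difference of the two sides is `-(1 - a)(1 - b)(1 - c) y x`. -/
theorem sub_mul_sub_comm_of_mul_eq_zero {A : Type*} [Ring A] {a b c x y : A} (hab : Commute a b)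
    (hbx : Commute b x) (hay : Commute a y) (hxy : x * y = c * (y * x))
    (h : (1 - a) * (1 - b) * (1 - c) = 0) :
    (x - a * x) * (y - b * y) = (y - b * y) * (x - a * x) := by
  have h1 : (x - a * x) * (y - b * y) = (1 - a) * (1 - b) * (x * y) := by
    calc (x - a * x) * (y - b * y) = (1 - a) * (x * y - (x * b) * y) := by noncomm_ring
      _ = _ := by rw [← hbx.eq]; noncomm_ring
  have h2 : (y - b * y) * (x - a * x) = (1 - a) * (1 - b) * (y * x) := by
    calc (y - b * y) * (x - a * x) = (1 - b) * (y * x - (y * a) * x) := by noncomm_ring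
      _ = (1 - a - b + b * a) * (y * x) := by rw [← hay.eq]; noncomm_ring
      _ = _ := by rw [← hab.eq]; noncomm_ring
  rw [h1, h2, hxy]
  calc (1 - a) * (1 - b) * (c * (y * x))
      = (1 - a) * (1 - b) * (y * x) - (1 - a) * (1 - b) * (1 - c) * (y * x) := by noncomm_ring
    _ = (1 - a) * (1 - b) * (y * x) := by rw [h, zero_mul, sub_zero]

/-- Each factor is a multiple of `1 - σ`, and `(1 - σ)³ = 1 - σ³ = 0` when `3 = 0`. -/
theorem one_sub_mul_of_cube {A : Type*} [Ring A] {σ : A} (h3 : (3 : A) = 0)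
    (hσ : σ * (σ * σ) = 1) {a b c : A} (ha : a = 1 ∨ a = σ ∨ a = σ * σ)
    (hb : b = 1 ∨ b = σ ∨ b = σ * σ) (hc : c = 1 ∨ c = σ ∨ c = σ * σ) :
    (1 - a) * (1 - b) * (1 - c) = 0 := by
  have hδ : (1 - σ) * ((1 - σ) * (1 - σ)) = 0 := by
    calc (1 - σ) * ((1 - σ) * (1 - σ)) = 1 - σ * (σ * σ) - 3 * (σ - σ * σ) := by noncomm_ring
      _ = 0 := by rw [hσ, h3, zero_mul, sub_self, sub_zero]
  have D : ∀ a, (a = 1 ∨ a = σ ∨ a = σ * σ) →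
      ∃ u, 1 - a = (1 - σ) * u ∧ u * (1 - σ) = (1 - σ) * u := by
    rintro a (rfl | rfl | rfl)
    · exact ⟨0, by simp, by simp⟩
    · exact ⟨1, by simp, by simp⟩
    · exact ⟨1 + σ, by noncomm_ring, by noncomm_ring⟩
  obtain ⟨u, hu, hu'⟩ := D a ha
  obtain ⟨v, hv, hv'⟩ := D b hb
  obtain ⟨w, hw, -⟩ := D c hc
  rw [hu, hv, hw]
  calc (1 - σ) * u * ((1 - σ) * v) * ((1 - σ) * w)
      = (1 - σ) * (u * (1 - σ)) * (v * (1 - σ)) * w := by noncomm_ring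
    _ = (1 - σ) * ((1 - σ) * u) * ((1 - σ) * v) * w := by rw [hu', hv']
    _ = (1 - σ) * (1 - σ) * (u * (1 - σ)) * v * w := by noncomm_ring
    _ = (1 - σ) * ((1 - σ) * (1 - σ)) * u * v * w := by rw [hu']; noncomm_ring
    _ = 0 := by rw [hδ]; simp

theorem skew_mul_comm {g h a b c : G} (hg : φ g = a * g) (hh : φ h = b * h)
    (hab : a * b = b * a) (hbg : b * g = g * b) (hah : a * h = h * a) (hgh : g * h = c * (h * g))
    (H : (1 - MonoidAlgebra.of R G a) * (1 - MonoidAlgebra.of R G b) *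
      (1 - MonoidAlgebra.of R G c) = 0) :
    φ.skew R g * φ.skew R h = φ.skew R h * φ.skew R g := by
  have e : ∀ x y : G, φ x = y * x → φ.skew R x =
      MonoidAlgebra.of R G x - MonoidAlgebra.of R G y * MonoidAlgebra.of R G x := by
    intro x y h
    rw [skew, h, ← _root_.map_mul]
    rfl
  rw [e g a hg, e h b hh]
  refine sub_mul_sub_comm_of_mul_eq_zero (c := MonoidAlgebra.of R G c) ?_ ?_ ?_ ?_ H
  · show _ * _ = _ * _
    rw [← _root_.map_mul, hab, _root_.map_mul]
  · show _ * _ = _ * _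
    rw [← _root_.map_mul, hbg, _root_.map_mul]
  · show _ * _ = _ * _
    rw [← _root_.map_mul, hah, _root_.map_mul]
  · rw [← _root_.map_mul, hgh, _root_.map_mul, _root_.map_mul]

theorem single_mul_skew_of_commute {r : R} {f g : G} (h : f * g = g * f) (h' : f * φ g = φ g * f) :
    MonoidAlgebra.single f r * φ.skew R g = φ.skew R g * MonoidAlgebra.single f r := by
  simp only [skew, mul_sub, sub_mul, MonoidAlgebra.single_mul_single, h, h', mul_one, one_mul]

/-- Exchanging `g` and `φ g` only changes a sign, which is invisible because `r = -r`. -/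
theorem single_mul_skew_of_swap {r : R} (hr : r ∈ twoTorsionIdeal R) {f g : G}
    (h : f * g = φ g * f) (h' : f * φ g = g * f) :
    MonoidAlgebra.single f r * φ.skew R g = φ.skew R g * MonoidAlgebra.single f r := by
  simp only [skew, mul_sub, sub_mul, MonoidAlgebra.single_mul_single, h, h', mul_one, one_mul]
  have hneg : r = -r := by
    rw [mem_twoTorsionIdeal, two_mul] at hr
    exact eq_neg_of_add_eq_zero_left hr
  have : ∀ x : G, MonoidAlgebra.single x r = -MonoidAlgebra.single x r := by
    intro x
    rw [← MonoidAlgebra.single_neg, ← hneg]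
  rw [sub_eq_add_neg, sub_eq_add_neg, ← this, ← this, add_comm]

theorem single_eq_of_sq_eq_bot (h : twoTorsionIdeal R ^ 2 = ⊥) {r s : R}
    (hr : r ∈ twoTorsionIdeal R) (hs : s ∈ twoTorsionIdeal R) : r * s = 0 := by
  have := Ideal.mul_mem_mul hr hs
  rw [← pow_two, h] at this
  exact this

theorem exists_mul_ne_zero (h : twoTorsionIdeal R ^ 2 ≠ ⊥) :
    ∃ r ∈ twoTorsionIdeal R, ∃ s ∈ twoTorsionIdeal R, r * s ≠ 0 := by
  by_contra! H
  refine h (le_bot_iff.mp ?_)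
  rw [pow_two, Ideal.mul_le]
  intro r hr s hs
  exact H r hr s hs

theorem three_eq_zero (h : ringChar R = 3) : (3 : R) = 0 := by
  have := ringChar.Nat.cast_ringChar (R := R)
  rw [h] at this
  exact_mod_cast this

theorem four_eq_zero (h : ringChar R = 4) : (4 : R) = 0 := by
  have := ringChar.Nat.cast_ringChar (R := R)
  rw [h] at this
  exact_mod_cast this

/-- A fixed `f` in `K` commutes with `g` and `φ g`; one outside `K` swaps them by conjugation. -/
theorem commute_of_abelian (hG : ∃ g h : G, g * h ≠ h * g)
    (hK : ∀ k ∈ φ.nonfixedSubgroup, ∀ l ∈ φ.nonfixedSubgroup, k * l = l * k)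
    (hR : twoTorsionIdeal R ^ 2 = ⊥) :
    ∀ α ∈ φ.antisymmetric R, ∀ β ∈ φ.antisymmetric R, α * β = β * α := by
  have hX : ∀ g, g ∉ φ.fixed → g ∈ φ.nonfixedSubgroup := fun g hg => Subgroup.subset_closure hg
  obtain ⟨-, -, -, -, hconj⟩ := exists_map_eq_conj hG hK
  rw [antisymmetric_commute_iff]
  refine ⟨fun g hg h hh => ?_, fun r hr f hf g hg => ?_, fun r hr s hs f _ f' _ => ?_⟩
  · have hg' := hX _ (map_notMem_fixed hg)
    have hh' := hX _ (map_notMem_fixed hh)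
    simp only [skew, mul_sub, sub_mul, MonoidAlgebra.single_mul_single,
      hK g (hX g hg) h (hX h hh), hK (φ g) hg' h (hX h hh), hK g (hX g hg) (φ h) hh',
      hK _ hg' _ hh', mul_one]
    abel
  · by_cases hfK : f ∈ φ.nonfixedSubgroup
    · exact single_mul_skew_of_commute (hK f hfK g (hX g hg))
        (hK f hfK _ (hX _ (map_notMem_fixed hg)))
    · refine single_mul_skew_of_swap hr ?_ ?_
      · rw [hconj f hfK g (hX g hg)]; group
      · have := hconj f hfK _ (hX _ (map_notMem_fixed hg))
        rw [φ.map_map] at this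
        conv_rhs => rw [this]
        group
  · rw [single_eq_of_sq_eq_bot hR hr hs, MonoidAlgebra.single_zero, MonoidAlgebra.single_zero]

/-- Nonfixed elements lie outside `A`, so the product of any two lies in `A` and is fixed; the four
terms of each product then match in pairs. -/
theorem commute_of_index_two (hR : twoTorsionIdeal R = ⊥) {A : Subgroup G} (hA : A.index = 2)
    (hAF : (A : Set G) ⊆ φ.fixed) :
    ∀ α ∈ φ.antisymmetric R, ∀ β ∈ φ.antisymmetric R, α * β = β * α := by
  rw [antisymmetric_commute_iff]
  refine ⟨fun g hg h hh => ?_, fun r hr f hf g hg => ?_, fun r hr s hs f _ f' _ => ?_⟩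
  · have P : ∀ x, x ∉ φ.fixed → ∀ y, y ∉ φ.fixed → x * y = φ y * φ x := by
      intro x hx y hy
      refine mul_mem_fixed_iff.mp (hAF ?_)
      rw [SetLike.mem_coe, Subgroup.mul_mem_iff_of_index_two hA]
      exact iff_of_false (fun h => hx (hAF h)) (fun h => hy (hAF h))
    have hg' := map_notMem_fixed hg
    have hh' := map_notMem_fixed hh
    have e1 := P g hg h hh
    have e2 := P h hh g hg
    have e3 := P g hg _ hh'
    have e4 := P _ hg' h hh
    rw [φ.map_map] at e3 e4
    simp only [skew, mul_sub, sub_mul, MonoidAlgebra.single_mul_single, mul_one, e1, e2, e3, e4]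
    abel
  · rw [hR, Ideal.mem_bot] at hr
    simp [hr]
  · rw [hR, Ideal.mem_bot] at hr
    simp [hr]

theorem commute_of_card_two (hR : ringChar R = 4) (h2 : Nat.card (commutator G) = 2)
    (hq : φ.onQuotient.fixed = Set.univ)
    (hF : twoTorsionIdeal R ^ 2 ≠ ⊥ → ∀ g ∈ φ.fixed, ∀ h ∈ φ.fixed, g * h = h * g) :
    ∀ α ∈ φ.antisymmetric R, ∀ β ∈ φ.antisymmetric R, α * β = β * α := by
  obtain ⟨s, s2, hs, hc, hφ⟩ := exists_central_of_card_two h2 hq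
  have hX : ∀ g, g ∉ φ.fixed → φ g = s * g := fun g hg => (hφ g).resolve_left hg
  rw [antisymmetric_commute_iff]
  refine ⟨fun g hg h hh => ?_, fun r hr f hf g hg => ?_, fun r hr r' hr' f hf f' hf' => ?_⟩
  · have : ∃ c, (c = 1 ∨ c = s) ∧ g * h = c * (h * g) := by
      rcases hc g h with e | e
      · exact ⟨1, Or.inl rfl, by rw [one_mul, e]⟩
      · exact ⟨s, Or.inr rfl, e⟩
    obtain ⟨c, hc', e⟩ := this
    refine skew_mul_comm (hX g hg) (hX h hh) rfl (hs g).symm (hs h).symm e ?_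
    have hσ : MonoidAlgebra.of R G s * MonoidAlgebra.of R G s = 1 := by
      rw [← _root_.map_mul, s2, _root_.map_one]
    have h4 : (4 : MonoidAlgebra R G) = 0 := by
      rw [← _root_.map_ofNat (algebraMap R (MonoidAlgebra R G)) 4]
      exact (congrArg _ (four_eq_zero hR)).trans (_root_.map_zero _)
    rcases hc' with rfl | rfl
    · rw [_root_.map_one, sub_self, mul_zero]
    · generalize MonoidAlgebra.of R G c = σ at hσ
      -- Since `σ² = 1`, the cube collapses to `4 (1 - σ)`, which is where characteristic 4 enters.
      calc (1 - σ) * (1 - σ) * (1 - σ) = 1 - 3 * σ + 3 * (σ * σ) - σ * σ * σ := by noncomm_ring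
        _ = 4 * (1 - σ) := by rw [hσ]; noncomm_ring
        _ = 0 := by rw [h4, zero_mul]
  · rcases hc f g with e | e
    · refine single_mul_skew_of_commute e ?_
      rw [hX g hg, ← mul_assoc, hs, mul_assoc, e, mul_assoc]
    · refine single_mul_skew_of_swap hr ?_ ?_
      · rw [hX g hg, e, mul_assoc]
      · rw [hX g hg, ← mul_assoc, hs, mul_assoc, e, ← mul_assoc, s2, one_mul]
  · by_cases hb : twoTorsionIdeal R ^ 2 = ⊥
    · rw [single_eq_of_sq_eq_bot hb hr hr', MonoidAlgebra.single_zero, MonoidAlgebra.single_zero]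
    · rw [hF hb f hf f' hf']

theorem commute_of_card_three (hR : ringChar R = 3) (h3 : Nat.card (commutator G) = 3)
    (hq : φ.onQuotient.fixed = Set.univ) (hcube : ∀ g : G, g ^ 3 ∈ φ.fixed) :
    ∀ α ∈ φ.antisymmetric R, ∀ β ∈ φ.antisymmetric R, α * β = β * α := by
  obtain ⟨s, s3, hc, hX⟩ := exists_of_card_three h3 hq hcube
  have hbot : ∀ r ∈ twoTorsionIdeal R, r = 0 := by
    intro r hr
    rw [mem_twoTorsionIdeal] at hr
    linear_combination r * three_eq_zero hR - hr
  rw [antisymmetric_commute_iff]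
  refine ⟨fun g hg h hh => ?_, fun r hr f hf g hg => ?_, fun r hr r' hr' f hf f' hf' => ?_⟩
  · obtain ⟨a, ha, hga⟩ : ∃ a, (a = s ∨ a = s * s) ∧ φ g = a * g := by
      rcases (hX g hg).2 with e | e
      · exact ⟨s, Or.inl rfl, e⟩
      · exact ⟨s * s, Or.inr rfl, e⟩
    obtain ⟨b, hb, hhb⟩ : ∃ a, (a = s ∨ a = s * s) ∧ φ h = a * h := by
      rcases (hX h hh).2 with e | e
      · exact ⟨s, Or.inl rfl, e⟩
      · exact ⟨s * s, Or.inr rfl, e⟩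
    obtain ⟨c, hc, hgh⟩ : ∃ c, (c = 1 ∨ c = s ∨ c = s * s) ∧ g * h = c * (h * g) := by
      rcases hc g h with e | e | e
      · exact ⟨1, Or.inl rfl, by rw [one_mul, e]⟩
      · exact ⟨s, Or.inr (Or.inl rfl), e⟩
      · exact ⟨s * s, Or.inr (Or.inr rfl), e⟩
    have gs : Commute s g := (hX g hg).1.symm
    have hs : Commute s h := (hX h hh).1.symm
    refine skew_mul_comm hga hhb ?_ ?_ ?_ hgh ?_
    · rcases ha with rfl | rfl <;> rcases hb with rfl | rfl <;> simp only [mul_assoc]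
    · rcases hb with rfl | rfl
      exacts [gs, gs.mul_left gs]
    · rcases ha with rfl | rfl
      exacts [hs, hs.mul_left hs]
    · have h3 : (3 : MonoidAlgebra R G) = 0 := by
        rw [← _root_.map_ofNat (algebraMap R (MonoidAlgebra R G)) 3]
        exact (congrArg _ (three_eq_zero hR)).trans (_root_.map_zero _)
      refine one_sub_mul_of_cube (σ := MonoidAlgebra.of R G s) h3 ?_ ?_ ?_ ?_
      · rw [← _root_.map_mul, ← _root_.map_mul, s3, _root_.map_one]
      · rcases ha with rfl | rfl
        exacts [Or.inr (Or.inl rfl), Or.inr (Or.inr (_root_.map_mul _ _ _))]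
      · rcases hb with rfl | rfl
        exacts [Or.inr (Or.inl rfl), Or.inr (Or.inr (_root_.map_mul _ _ _))]
      · rcases hc with rfl | rfl | rfl
        exacts [Or.inl (_root_.map_one _), Or.inr (Or.inl rfl),
          Or.inr (Or.inr (_root_.map_mul _ _ _))]
  · rw [hbot r hr]
    simp
  · rw [hbot r hr]
    simp

/-! ### Necessity of the four conditions -/

/-- A nonzero product `r * s` in `R₂²` makes all fixed elements commute. For `x` outside `K` and `k
∈ K`, both `x` and `x * k` are fixed, so `x` centralises `K`; then `φ` is trivial on `K`, everything
is fixed, and `G` is abelian. -/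
theorem sq_eq_bot_of_abelian (hG : ∃ g h : G, g * h ≠ h * g)
    (hK : ∀ k ∈ φ.nonfixedSubgroup, ∀ l ∈ φ.nonfixedSubgroup, k * l = l * k)
    (H : ∀ α ∈ φ.antisymmetric R, ∀ β ∈ φ.antisymmetric R, α * β = β * α) :
    twoTorsionIdeal R ^ 2 = ⊥ := by
  obtain ⟨-, -, hc⟩ := φ.antisymmetric_commute_iff.mp H
  by_contra hb
  obtain ⟨r, hr, s, hs, hrs⟩ := exists_mul_ne_zero hb
  have hF : ∀ f ∈ φ.fixed, ∀ f' ∈ φ.fixed, f * f' = f' * f := fun f hf f' hf' =>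
    (MonoidAlgebra.single_left_inj hrs).mp (hc r hr s hs f hf f' hf')
  have hX : ∀ k, k ∉ φ.nonfixedSubgroup → k ∈ φ.fixed := fun k hk => by
    by_contra h
    exact hk (Subgroup.subset_closure h)
  obtain ⟨x, hx, hxK, -, hconj⟩ := exists_map_eq_conj hG hK
  have hfix : ∀ k, k ∈ φ.fixed := by
    intro k
    by_cases hk : k ∈ φ.nonfixedSubgroup
    · have := hF x hx (x * k) (hX _ fun h => hxK ((Subgroup.mul_mem_cancel_right _ hk).mp h))
      rw [mul_assoc] at this
      rw [mem_fixed, hconj x hxK k hk, mul_left_cancel this, mul_inv_cancel_right]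
    · exact hX k hk
  obtain ⟨g, h, hgh⟩ := hG
  exact hgh (hF g (hfix g) h (hfix h))

theorem exists_not_commute_of_nonfixedSubgroup
    (hK : ¬∀ k ∈ φ.nonfixedSubgroup, ∀ l ∈ φ.nonfixedSubgroup, k * l = l * k) :
    ∃ g, g ∉ φ.fixed ∧ ∃ h, h ∉ φ.fixed ∧ g * h ≠ h * g := by
  by_contra! H
  have : IsMulCommutative φ.nonfixedSubgroup :=
    Subgroup.isMulCommutative_closure fun a ha b hb => H a ha b hb
  exact hK fun k hk l hl =>
    congrArg Subtype.val (mul_comm' (⟨k, hk⟩ : φ.nonfixedSubgroup) ⟨l, hl⟩)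

theorem card_two_of_not_abelian [Nontrivial R] (hR : ringChar R ≠ 2)
    (h2 : twoTorsionIdeal R ≠ ⊥)
    (hK : ¬∀ k ∈ φ.nonfixedSubgroup, ∀ l ∈ φ.nonfixedSubgroup, k * l = l * k)
    (H : ∀ α ∈ φ.antisymmetric R, ∀ β ∈ φ.antisymmetric R, α * β = β * α) :
    ringChar R = 4 ∧ Nat.card (commutator G) = 2 ∧ φ.onQuotient.fixed = Set.univ ∧
      (∀ g : G, g ^ 2 ∈ φ.fixed) ∧
      (twoTorsionIdeal R ^ 2 ≠ ⊥ → ∀ g ∈ φ.fixed, ∀ h ∈ φ.fixed, g * h = h * g) := by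
  obtain ⟨ha, hb, hc⟩ := φ.antisymmetric_commute_iff.mp H
  obtain ⟨r, hr, hr0⟩ := Submodule.exists_mem_ne_zero_of_ne_bot h2
  have hr2 := mem_twoTorsionIdeal.mp hr
  have no3 : ringChar R ≠ 3 := fun h => hr0 (by linear_combination r * three_eq_zero h - hr2)
  have B : ∀ f ∈ φ.fixed, ∀ g, g ∉ φ.fixed →
      f * g = g * f ∨ (f * g = φ g * f ∧ f * φ g = g * f) := fun f hf g hg =>
    commute_or_swap hr0 hg (hb r hr f hf g hg)
  have T : ∀ g, g ∉ φ.fixed → ∀ h, h ∉ φ.fixed → g * h = h * g ∨ g * h = φ h * φ g ∨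
      (ringChar R = 4 ∧ g * h = φ g * φ h ∧ g * h = h * φ g ∧ g * h = φ h * g) := by
    intro g hg h hh
    rcases trichotomy_of_skew_commute hR hg hh (ha g hg h hh) with e | e | ⟨e, -⟩ | e
    · exact Or.inl e
    · exact Or.inr (Or.inl e)
    · exact absurd e no3
    · exact Or.inr (Or.inr e)
  obtain ⟨k, hk, l, hl, hkl⟩ := exists_not_commute_of_nonfixedSubgroup hK
  obtain ⟨s, s2, s1, hgh, hs, hφ⟩ := exists_central_of_not_commute
    (fun g hg h hh => (T g hg h hh).imp_right (Or.imp_right And.right)) B hk hl hkl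
  -- A fixed product `k * l` would equal `φ l * φ k = s * l * (s * k) = l * k`.
  have h4 : ringChar R = 4 := by
    rcases T k hk l hl with e | e | e
    · exact absurd e hkl
    · rw [(hφ k).resolve_left hk, (hφ l).resolve_left hl, mul_assoc, ← mul_assoc l, hs, mul_assoc,
        ← mul_assoc, s2, one_mul] at e
      exact absurd e hkl
    · exact e.1
  have hz : ∀ a, φ a * a⁻¹ ∈ Subgroup.zpowers s := by
    intro a
    rcases hφ a with e | e <;> rw [e]
    · rw [mul_inv_cancel]
      exact one_mem _
    · rw [mul_inv_cancel_right]
      exact Subgroup.mem_zpowers s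
  obtain ⟨hG', hq⟩ := commutator_eq_zpowers hs hz hgh
  refine ⟨h4, ?_, hq, fun g => ?_, fun hne f hf f' hf' => ?_⟩
  · rw [hG', Nat.card_zpowers]
    exact orderOf_eq_prime (by rw [pow_two, s2]) s1
  · rw [pow_two, mem_fixed, φ.map_mul]
    rcases hφ g with e | e <;> rw [e]
    rw [mul_assoc, ← mul_assoc g, hs, mul_assoc, ← mul_assoc, s2, one_mul]
  · obtain ⟨r, hr, s, hs, hrs⟩ := exists_mul_ne_zero hne
    exact (MonoidAlgebra.single_left_inj hrs).mp (hc r hr s hs f hf f' hf')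

theorem CubicPair.not_mul_eq {g h : G} (H : φ.CubicPair g h) (h1 : g * h = φ h * φ g)
    (h2 : g * φ h = h * φ g) : False := by
  obtain ⟨s, s3, s1, gs, hs, gh, hg, hh⟩ := H
  have s2 : s * s ≠ 1 := fun e => s1 (by rwa [e, mul_one] at s3)
  rcases hg with hg | hg <;> rcases hh with hh | hh <;> rw [hg, hh] at h1 h2 <;>
    simp only [gh, mul_assoc, reassoc hs, reassoc gs, reassoc₃ s3, one_mul, mul_right_inj] at h1 h2
  · exact s1 (mul_eq_right.mp h1.symm)
  · exact s1 (mul_eq_right.mp h1)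
  · exact s1 (mul_eq_right.mp h1)
  · exact s2 (mul_eq_right.mp ((mul_assoc _ _ _).trans h2.symm))

theorem index_two_or_card_three [Nontrivial R] (hR : ringChar R ≠ 2)
    (h2 : twoTorsionIdeal R = ⊥)
    (hK : ¬∀ k ∈ φ.nonfixedSubgroup, ∀ l ∈ φ.nonfixedSubgroup, k * l = l * k)
    (H : ∀ α ∈ φ.antisymmetric R, ∀ β ∈ φ.antisymmetric R, α * β = β * α) :
    (∃ A : Subgroup G, A.index = 2 ∧ (∀ a ∈ A, ∀ b ∈ A, a * b = b * a) ∧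
      (A : Set G) ⊆ φ.fixed) ∨
    (ringChar R = 3 ∧ Nat.card (commutator G) = 3 ∧ φ.onQuotient.fixed = Set.univ ∧
      (∀ g : G, g ^ 3 ∈ φ.fixed)) := by
  obtain ⟨ha, -, -⟩ := φ.antisymmetric_commute_iff.mp H
  have no4 : ringChar R ≠ 4 := fun h => by
    have h4 : (2 : R) ∈ twoTorsionIdeal R := by
      rw [mem_twoTorsionIdeal]
      linear_combination four_eq_zero h
    rw [h2, Ideal.mem_bot] at h4
    exact two_ne_zero_of_ringChar hR h4
  have T₀ := fun g hg h hh => trichotomy_of_skew_commute hR hg hh (ha g hg h hh)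
  have T : φ.SkewTrichotomy := by
    intro g hg h hh
    rcases T₀ g hg h hh with e | e | ⟨-, e⟩ | ⟨e, -⟩
    · exact Or.inl e
    · exact Or.inr (Or.inl e)
    · exact Or.inr (Or.inr e)
    · exact absurd e no4
  have T' : φ.PairTrichotomy := fun g hg h hh => T.commute_or_fixedPair_or_cubic hg hh
  by_cases hC : ∃ g, g ∉ φ.fixed ∧ ∃ h, h ∉ φ.fixed ∧ φ.CubicPair g h
  · right
    obtain ⟨g, hg, h, hh, hgh⟩ := hC
    -- If `g * h` is fixed, its coefficient says nothing about the characteristic; then the cubic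
    -- pair `(g, φ h)` is used, since `CubicPair.not_mul_eq` forbids both products to be fixed.
    have h3 : ringChar R = 3 := by
      rcases T₀ g hg h hh with e | e | ⟨e, -⟩ | ⟨e, -⟩
      · exact absurd e hgh.not_commute
      · rcases T₀ g hg _ (map_notMem_fixed hh) with e' | e' | ⟨e', -⟩ | ⟨e', -⟩
        · exact absurd e' hgh.map_right.not_commute
        · rw [φ.map_map] at e'
          exact (hgh.not_mul_eq e e').elim
        · exact e'
        · exact absurd e' no4
      · exact e
      · exact absurd e no4
    obtain ⟨s, s3, s1, hgh, hs, hφ⟩ := T'.exists_of_cubicPair hg hh hgh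
    have hz : ∀ a, φ a * a⁻¹ ∈ Subgroup.zpowers s := by
      intro a
      rcases hφ a with e | e | e <;> rw [e]
      · rw [mul_inv_cancel]
        exact one_mem _
      · rw [mul_inv_cancel_right]
        exact Subgroup.mem_zpowers s
      · rw [← mul_assoc, mul_inv_cancel_right]
        exact mul_mem (Subgroup.mem_zpowers s) (Subgroup.mem_zpowers s)
    obtain ⟨hG', hq⟩ := commutator_eq_zpowers hs hz hgh
    refine ⟨h3, ?_, hq, fun g => ?_⟩
    · rw [hG', Nat.card_zpowers]
      exact orderOf_eq_prime (by rw [← s3, pow_succ, pow_two, mul_assoc]) s1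
    · rw [pow_succ, pow_two, mul_assoc, mem_fixed, φ.map_mul, φ.map_mul]
      have gs := hs g
      rcases hφ g with e | e | e <;> rw [e] <;>
        simp only [mul_assoc, reassoc gs, reassoc₃ s3, one_mul]
  · left
    push Not at hK
    obtain ⟨k, hk, l, hl, hkl⟩ := hK
    refine SkewDichotomy.exists_index_two (fun g hg h hh => ?_) hk hl hkl
    rcases T' g hg h hh with e | e | e
    · exact Or.inl e
    · exact Or.inr e
    · exact absurd ⟨g, hg, h, hh, e⟩ hC

end GroupInvolution

theorem mainTheorem1 {R : Type*} [CommRing R] [Nontrivial R] (hR : ringChar R ≠ 2)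
    {G : Type*} [Group G] (hG : ∃ g h : G, g * h ≠ h * g) (φ : GroupInvolution G) :
    ((∀ α ∈ φ.antisymmetric R, ∀ β ∈ φ.antisymmetric R, α * β = β * α) ↔
      (((∀ k ∈ φ.nonfixedSubgroup, ∀ l ∈ φ.nonfixedSubgroup, k * l = l * k) ∧
          twoTorsionIdeal R ^ 2 = ⊥) ∨
        (twoTorsionIdeal R = ⊥ ∧
          ∃ A : Subgroup G, A.index = 2 ∧ (∀ a ∈ A, ∀ b ∈ A, a * b = b * a) ∧
            (A : Set G) ⊆ φ.fixed) ∨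
        (ringChar R = 4 ∧ Nat.card (commutator G) = 2 ∧ φ.onQuotient.fixed = Set.univ ∧
          (∀ g : G, g ^ 2 ∈ φ.fixed) ∧
          (twoTorsionIdeal R ^ 2 ≠ ⊥ →
            ∀ g ∈ φ.fixed, ∀ h ∈ φ.fixed, g * h = h * g)) ∨
        (ringChar R = 3 ∧ Nat.card (commutator G) = 3 ∧ φ.onQuotient.fixed = Set.univ ∧
          (∀ g : G, g ^ 3 ∈ φ.fixed)))) ∧
    ((∀ k ∈ φ.nonfixedSubgroup, ∀ l ∈ φ.nonfixedSubgroup, k * l = l * k) →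
      ∃ x ∈ φ.fixed,
        (∀ g : G, g ∈ φ.nonfixedSubgroup ∨ ∃ k ∈ φ.nonfixedSubgroup, g = k * x) ∧
        (∀ k ∈ φ.nonfixedSubgroup, φ k = x * k * x⁻¹)) := by
  refine ⟨⟨fun H => ?_, ?_⟩, fun hK => ?_⟩
  · by_cases hK : ∀ k ∈ φ.nonfixedSubgroup, ∀ l ∈ φ.nonfixedSubgroup, k * l = l * k
    · exact Or.inl ⟨hK, GroupInvolution.sq_eq_bot_of_abelian hG hK H⟩
    · by_cases h2 : twoTorsionIdeal R = ⊥
      · rcases GroupInvolution.index_two_or_card_three hR h2 hK H with h | h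
        · exact Or.inr (Or.inl ⟨h2, h⟩)
        · exact Or.inr (Or.inr (Or.inr h))
      · exact Or.inr (Or.inr (Or.inl (GroupInvolution.card_two_of_not_abelian hR h2 hK H)))
  · rintro (⟨hK, h2⟩ | ⟨h2, A, hA, -, hAF⟩ | ⟨h4, hc, hq, -, hF⟩ | ⟨h3, hc, hq, hcube⟩)
    · exact GroupInvolution.commute_of_abelian hG hK h2
    · exact GroupInvolution.commute_of_index_two h2 hA hAF
    · exact GroupInvolution.commute_of_card_two h4 hc hq hF
    · exact GroupInvolution.commute_of_card_three h3 hc hq hcube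
  · obtain ⟨x, hx, hxK, hcov, hconj⟩ := GroupInvolution.exists_map_eq_conj hG hK
    exact ⟨x, hx, hcov, hconj x hxK⟩
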